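/- Let $X\subset\mathbb{C}^n$ be a domain (a non-empty open connected set) and let $\mathrm{Aut}(X)$ be the set of biholomorphic self-maps of $X$. Let $K:X\times X\to\mathbb{C}$ be holomorphic in the first variable and antiholomorphic in the second, non-degenerate (i.e. $K(x,x)>0$ for every $x\in X$) and positive semi-definite (i.e. every matrix $(K(x_i,x_j))_{i,j}$ with $x_1,\dots,x_m\in X$ is positive semi-definite). Let $F$ be the reproducing kernel Hilbert space of functions on $X$ with kernel $K$, let $F^*$ be its dual with the dual inner product (linear in the first variable), so that $F^*$ is again a Hilbert space, and let $\kappa:X\to F^*$ be the evaluation map $\kappa(x)f=f(x)$, so that $\langle\kappa(x),\kappa(y)\rangle_{F^*}=K(x,y)$. For $x\in X$ and $u,v\in T_xX=\mathbb{C}^n$ put $$\tilde\sigma^K_x(u,v)=\frac{\langle D\kappa_x u,D\kappa_x v\rangle}{\|\kappa(x)\|^2}-\frac{\langle D\kappa_x u,\kappa(x)\rangle\langle\kappa(x),D\kappa_x v\rangle}{\|\kappa(x)\|^4}$$ (the pull-back of the Fubini–Study metric via $\kappa$), and for $x,y\in X$ put $$\delta_1^K(x,y)=\sqrt{1-\frac{|\langle\kappa(x),\kappa(y)\rangle|^2}{\|\kappa(x)\|^2\|\kappa(y)\|^2}},\qquad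 \delta_2^K(x,y)=\sqrt{2-2\frac{|\langle\kappa(x),\kappa(y)\rangle|}{\|\kappa(x)\|\,\|\kappa(y)\|}}.$$ The following are equivalent: (i) $K$ is projectively invariant, i.e. for every $\Phi\in\mathrm{Aut}(X)$ there is a function $\omega:X\to\mathbb{C}$ with $K(\Phi(x),\Phi(y))=\omega(x)\overline{\omega(y)}K(x,y)$ for all $x,y\in X$; (ii) for every $\Phi\in\mathrm{Aut}(X)$ there is a function $\omega:X\to\mathbb{C}$ such that the weighted composition operator $W_{\omega,\Phi}f=\omega\cdot(f\circ\Phi)$ is well defined on $F$ and is a unitary operator on $F$; (iii$_0$) $\tilde\sigma^K$ is automorphism-invariant, i.e. $\tilde\sigma^K_{\Phi(x)}(D\Phi_xu,D\Phi_xv)=\tilde\sigma^K_x(u,v)$ for all $\Phi\in\mathrm{Aut}(X)$, $x\in X$ and $u,v\in\mathbb{C}^n$; (iii$_1$) $\delta_1^K$ is automorphism-invariant, i.e. $\delta_1^K(\Phi(x),\Phi(y))=\delta_1^K(x,y)$ for all $\Phi\in\mathrm{Aut}(X)$ and $x,y\in X$; (iii$_2$) $\delta_2^K$ is automorphism-invariant,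 in the same sense; (iv) for every $\Phi\in\mathrm{Aut}(X)$ there are $y\in X$ and a non-empty open set $U\subset X$ such that for every $x\in U$ $$\frac{|K(\Phi(x),\Phi(y))|^2}{K(\Phi(x),\Phi(x))K(\Phi(y),\Phi(y))}=\frac{|K(x,y)|^2}{K(x,x)K(y,y)}.$$ -/

import Mathlib

open scoped ComplexOrder ComplexConjugate

noncomputable section

namespace ProjectiveKernel

section Domain

variable {n : ℕ} {X : Set (EuclideanSpace ℂ (Fin n))}

/-- Extension by zero of a map on `X` to all of `ℂⁿ`; only its values on `X` (and, `X` being open,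
its germs at points of `X`) are ever used. -/
def ext {V : Type*} [Zero V] (f : X → V) : EuclideanSpace ℂ (Fin n) → V :=
  Function.extend Subtype.val f 0

/-- `f : X → V` is holomorphic, for `X` open in `ℂⁿ` and `V` a complex normed space. -/
def IsHolomorphic {V : Type*} [NormedAddCommGroup V] [NormedSpace ℂ V] (f : X → V) : Prop :=
  DifferentiableOn ℂ (ext f) X

/-- The differential `D f_x : T_x → V`, where `T_x = T_x^{1,0} X` is identified with `ℂⁿ`. -/
def differential {V : Type*} [NormedAddCommGroup V] [NormedSpace ℂ V] (f : X → V) (x : X) :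
    EuclideanSpace ℂ (Fin n) →L[ℂ] V :=
  fderiv ℂ (ext f) x

/-- `Φ` is an automorphism (a biholomorphic self-map) of `X`. -/
def IsAutomorphism (Φ : X ≃ X) : Prop :=
  IsHolomorphic (fun x => (Φ x : EuclideanSpace ℂ (Fin n))) ∧
    IsHolomorphic (fun x => (Φ.symm x : EuclideanSpace ℂ (Fin n)))

/-- Holomorphic in the first variable, antiholomorphic in the second. -/
def IsSesquiHolomorphic (L : X → X → ℂ) : Prop :=
  (∀ y, IsHolomorphic (fun x => L x y)) ∧ ∀ x, IsHolomorphic (fun y => conj (L x y))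

end Domain

section Kernels

variable {X : Type*}

/-- `L x x` is real and positive for all `x`. -/
def IsNondegenerate (L : X → X → ℂ) : Prop := ∀ x, 0 < L x x

def IsPosSemidefKernel (K : X → X → ℂ) : Prop :=
  ∀ (m : ℕ) (x : Fin m → X), (Matrix.of fun i j => K (x i) (x j)).PosSemidef

/-- `M` is a rescaling of `L`. -/
def IsRescaling (M L : X → X → ℂ) : Prop :=
  ∃ ω : X → ℂ, ∀ x y, M x y = ω x * conj (ω y) * L x y

/-- `|L (x, y)|² / (L (x, x) L (y, y))`. -/
def normalizedSq (L : X → X → ℂ) (x y : X) : ℂ :=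
  ((‖L x y‖ ^ 2 : ℝ) : ℂ) / (L x x * L y y)

end Kernels

section Dual

variable {F : Type*} [NormedAddCommGroup F] [InnerProductSpace ℂ F] [CompleteSpace F]

/-- The inner product of `F*`, linear in the first variable `f`: Riesz representation is antilinear
and Mathlib's `inner` is antilinear in its first argument. -/
def dualInner (f h : StrongDual ℂ F) : ℂ :=
  inner ℂ ((InnerProductSpace.toDual ℂ F).symm f) ((InnerProductSpace.toDual ℂ F).symm h)

/-- The (degenerate) Fubini–Study metric at `g ∈ F* \ {0}`. -/
def fubiniStudy (g f h : StrongDual ℂ F) : ℂ :=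
  dualInner f h / (‖g‖ : ℂ) ^ 2 - dualInner f g * dualInner g h / (‖g‖ : ℂ) ^ 4

def delta₁ (g h : StrongDual ℂ F) : ℝ :=
  Real.sqrt (1 - ‖dualInner g h‖ ^ 2 / (‖g‖ ^ 2 * ‖h‖ ^ 2))

def delta₂ (g h : StrongDual ℂ F) : ℝ :=
  Real.sqrt (2 - 2 * (‖dualInner g h‖ / (‖g‖ * ‖h‖)))

end Dual

section RKHS

variable {X : Type*} (F : Type*) [NormedAddCommGroup F] [InnerProductSpace ℂ F] [CompleteSpace F]
  [RKHS ℂ F X ℂ]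

/-- The scalar function `K` is the reproducing kernel of `F`: `K (x, y) = K_y (x)`. -/
def HasKernel (K : X → X → ℂ) : Prop :=
  ∀ x y, K x y = RKHS.kerFun F y (1 : ℂ) x

/-- The evaluation map `κ (x) = K_x^* ∈ F*`, i.e. `κ (x) f = f (x)`. -/
def evalMap (x : X) : StrongDual ℂ F :=
  InnerProductSpace.toDual ℂ F (RKHS.kerFun F x (1 : ℂ))

theorem evalMap_apply (x : X) (f : F) : evalMap F x f = f x := by
  simp [evalMap]

/-- The weighted composition operator `W_{ω,Φ} f = ω · (f ∘ Φ)` is well defined on `F` and equal to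
the bounded operator `W`. -/
def IsWeightedComposition (W : F →L[ℂ] F) (ω : X → ℂ) (Φ : X → X) : Prop :=
  ∀ (f : F) (x : X), (W f) x = ω x * f (Φ x)

end RKHS

section Existence

universe u

/-- Every positive semi-definite kernel has a reproducing kernel Hilbert space (Moore–Aronszajn),
so that `HasKernel` is satisfiable for all kernels in question. -/
theorem exists_hasKernel {X : Type u} (K : X → X → ℂ) (hK : IsPosSemidefKernel K) :
    ∃ (F : Type u) (_ : NormedAddCommGroup F) (_ : InnerProductSpace ℂ F) (_ : CompleteSpace F)
      (_ : RKHS ℂ F X ℂ), HasKernel F K := by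
  let M : Matrix X X (ℂ →L[ℂ] ℂ) := Matrix.of fun x y => K x y • ContinuousLinearMap.id ℂ ℂ
  have hMa : ∀ x y z, M x y z = K x y * z := fun x y z => by simp [M]
  have herm : ∀ x y, conj (K x y) = K y x := fun x y => by
    have := (hK 2 ![x, y]).1.apply 1 0
    simpa using this
  have hM : M.PosSemidef := by
    have key : M.IsHermitian ∧ ∀ (vv : X →₀ ℂ),
        0 ≤ RCLike.re (vv.sum fun x w ↦ vv.sum fun x' w' ↦ inner ℂ (M x' x w) w') := by
      refine ⟨?_, fun vv => ?_⟩
      · ext x y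
        refine ext_inner_right ℂ fun w => ?_
        rw [Matrix.conjTranspose_apply, ContinuousLinearMap.star_eq_adjoint,
          ContinuousLinearMap.adjoint_inner_left, hMa, hMa]
        simp [herm, mul_comm]
      · have h := hK _ (fun i => (vv.support.equivFin.symm i : X))
        have h2 := h.dotProduct_mulVec_nonneg (fun i => vv (vv.support.equivFin.symm i : X))
        have h3 := (Complex.le_def.1 h2).1
        simp only [Complex.zero_re, dotProduct, Matrix.mulVec, Finset.mul_sum,
          Matrix.of_apply] at h3
        refine h3.trans_eq ?_
        change Complex.re _ = Complex.re _
        congr 1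
        simp only [Finsupp.sum, hMa]
        rw [Finset.sum_comm]
        conv_rhs => rw [← Finset.sum_coe_sort, ← Equiv.sum_comp vv.support.equivFin.symm]
        rw [Finset.sum_comm]
        refine Finset.sum_congr rfl fun i _ => ?_
        conv_rhs => rw [← Finset.sum_coe_sort, ← Equiv.sum_comp vv.support.equivFin.symm]
        refine Finset.sum_congr rfl fun j _ => ?_
        simp [herm]
        ring
    exact (RKHS.posSemidef_tfae.out 0 2).2 key
  have : Fact M.PosSemidef := ⟨hM⟩
  refine ⟨RKHS.OfKernel M, inferInstance, inferInstance, inferInstance, inferInstance, ?_⟩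
  intro x y
  rw [RKHS.kerFun_apply, RKHS.OfKernel.kernel_ofKernel, hMa, mul_one]

end Existence

section PullBack

variable {n : ℕ} {X : Set (EuclideanSpace ℂ (Fin n))} (F : Type*) [NormedAddCommGroup F]
  [InnerProductSpace ℂ F] [CompleteSpace F] [RKHS ℂ F X ℂ]

/-- The pull-back `σ̃^K_x (u, v)` of the Fubini–Study metric through `κ`, for `u, v ∈ T_x`. -/
def pullbackFubiniStudy (x : X) (u v : EuclideanSpace ℂ (Fin n)) : ℂ :=
  fubiniStudy (evalMap F x) (differential (evalMap F) x u) (differential (evalMap F) x v)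

/-- The pull-back `δ₁^K`. -/
def pullbackDelta₁ (x y : X) : ℝ := delta₁ (evalMap F x) (evalMap F y)

/-- The pull-back `δ₂^K`. -/
def pullbackDelta₂ (x y : X) : ℝ := delta₂ (evalMap F x) (evalMap F y)

end PullBack

section Invariance

variable {n : ℕ} {X : Set (EuclideanSpace ℂ (Fin n))}

def IsProjectivelyInvariant (L : X → X → ℂ) : Prop :=
  ∀ Φ : X ≃ X, IsAutomorphism Φ → IsRescaling (fun x y => L (Φ x) (Φ y)) L

/-- A field of forms `σ_x` on the tangent spaces `T_x` is automorphism-invariant: `Φ^* σ = σ`. -/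
def IsAutInvariantForm
    (σ : X → EuclideanSpace ℂ (Fin n) → EuclideanSpace ℂ (Fin n) → ℂ) : Prop :=
  ∀ Φ : X ≃ X, IsAutomorphism Φ → ∀ (x : X) (u v : EuclideanSpace ℂ (Fin n)),
    σ (Φ x) (differential (fun z => (Φ z : EuclideanSpace ℂ (Fin n))) x u)
      (differential (fun z => (Φ z : EuclideanSpace ℂ (Fin n))) x v) = σ x u v

/-- A (pseudo)distance on `X` is automorphism-invariant. -/
def IsAutInvariantDist (d : X → X → ℝ) : Prop :=
  ∀ Φ : X ≃ X, IsAutomorphism Φ → ∀ x y, d (Φ x) (Φ y) = d x y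

end Invariance

end ProjectiveKernel

end

open scoped ComplexOrder ComplexConjugate

namespace ProjectiveKernel

/-! ### Submean value estimates with a small exceptional set -/

section SubmeanValue

open MeasureTheory Metric Set Real

/-! Everything compares the curves `κ` and `l = κ ∘ Φ` in `F*` through their Gram kernels. If these
differ by a factor `ω x * conj (ω y)`, then the kernel functions at `x` and the rescaled ones at `Φ
x` have the same Gram matrix, so matching them extends to a unitary, whose inverse is a weighted
composition operator. Such an operator carries `κ` to a scalar multiple of `l`, and the Fubini–Study
form sees neither unitaries nor scalar factors.

Conversely, the pulled-back form is `∂∂̄ log ⟨κ, κ⟩`. Polarized on a complex line, equality of the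
two forms says that the mixed derivative of `log (⟨κ s, κ t⟩ / ⟨l s, l t⟩)` vanishes; integrating in
each variable from a base point gives equality of the normalized kernels near that point
(`dualInner_mul_eq_of_fubiniStudy_eq`, in the spirit of Calabi's diastasis). Polarization and the
identity theorem spread this to `X × X`; fixing one argument exhibits `ω`, and the zeros of the
kernel are bypassed by changing the base point (`exists_rescaling_of_diagonal`). Both distances are
injective functions of the normalized kernel, so they fit in between.

All this needs `κ` to be holomorphic into `F*`, while `K` is only separately holomorphic and
antiholomorphic. Weak holomorphy on a total set together with local boundedness suffices
(`differentiableAt_toDual`). Local boundedness is a Hartogs-type statement: Baire gives it near some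
points, and `exists_bound_of_bound_ball` enlarges a ball of boundedness past its radius. -/

theorem log_norm_le_circleAverage_posLog {g : ℂ → ℂ} (hg : AnalyticOnNhd ℂ g (closedBall 0 1)) :
    Real.log ‖g 0‖ ≤ circleAverage (fun z => log⁺ ‖g z‖) 0 1 := by
  have hmer : MeromorphicOn g (sphere 0 |(1 : ℝ)|) := by
    rw [abs_one]
    exact (hg.mono sphere_subset_closedBall).meromorphicOn
  by_cases h0 : g 0 = 0
  -- Here `Real.log 0 = 0`, so the left-hand side is `0`, not `-∞`.
  · rw [h0, norm_zero, Real.log_zero]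
    exact circleAverage_nonneg_of_nonneg fun _ _ => posLog_nonneg
  have jensen := AnalyticOnNhd.circleAverage_log_norm (R := 1) (c := 0) one_ne_zero
    (by rwa [abs_one]) h0
  -- In Jensen's formula each zero in the disc contributes a nonnegative term; the term at `u = 0`
  -- vanishes because `Real.log 0 = 0`.
  have hsum : 0 ≤ ∑ᶠ u, (MeromorphicOn.divisor g (closedBall 0 |(1 : ℝ)|) u : ℝ)
      * Real.log (1 * ‖(0 : ℂ) - u‖⁻¹) := by
    refine finsum_nonneg fun u => ?_
    by_cases hu : u ∈ closedBall (0 : ℂ) |(1 : ℝ)|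
    · refine mul_nonneg ?_ ?_
      · exact mod_cast MeromorphicOn.AnalyticOnNhd.divisor_nonneg
          (U := closedBall 0 |(1 : ℝ)|) (by rwa [abs_one]) u
      · rcases eq_or_ne u 0 with rfl | hu0
        · simp
        · refine Real.log_nonneg ?_
          rw [one_mul, zero_sub, norm_neg]
          exact (one_le_inv₀ (norm_pos_iff.2 hu0)).2 (by simpa using hu)
    · simp [Function.locallyFinsuppWithin.apply_eq_zero_of_notMem _ hu]
  have hle : circleAverage (fun z => Real.log ‖g z‖) 0 1 ≤
      circleAverage (fun z => log⁺ ‖g z‖) 0 1 :=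
    circleAverage_mono hmer.circleIntegrable_log_norm hmer.circleIntegrable_posLog_norm
      fun z _ => le_max_right _ _
  linarith

/-- If a holomorphic function is bounded by `B` on the unit circle and by `1` on at least half of
it, then its value at the centre is bounded by `√B`. -/
theorem norm_sq_le_of_volume_le {g : ℂ → ℂ} (hg : AnalyticOnNhd ℂ g (closedBall 0 1)) {B : ℝ}
    (hB : 1 ≤ B) (hgB : ∀ z ∈ sphere (0 : ℂ) 1, ‖g z‖ ≤ B)
    (hvol : volume ({θ : ℝ | 1 < ‖g (circleMap 0 1 θ)‖} ∩ Ioc 0 (2 * π)) ≤ ENNReal.ofReal π) :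
    ‖g 0‖ ^ 2 ≤ B := by
  have hBpos : 0 < B := by linarith
  by_cases h0 : g 0 = 0
  · simpa [h0] using hBpos.le
  have hlogB : 0 ≤ Real.log B := Real.log_nonneg hB
  set S : Set ℝ := {θ : ℝ | 1 < ‖g (circleMap 0 1 θ)‖} with hS
  have hcirc : ∀ θ : ℝ, circleMap 0 1 θ ∈ sphere (0 : ℂ) 1 := fun θ =>
    circleMap_mem_sphere 0 zero_le_one θ
  have hcont : Continuous fun θ : ℝ => ‖g (circleMap 0 1 θ)‖ := by
    refine Continuous.norm ?_
    have : ContinuousOn g (sphere 0 1) := hg.continuousOn.mono sphere_subset_closedBall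
    exact this.comp_continuous (continuous_circleMap 0 1) hcirc
  have hSm : MeasurableSet S := (isOpen_lt continuous_const hcont).measurableSet
  -- `log⁺` discards the good angles, and the bad ones have measure at most `π` out of `2π`: this is
  -- the source of the exponent `1/2` on `B`.
  have hpt : ∀ θ, log⁺ ‖g (circleMap 0 1 θ)‖ ≤ S.indicator (fun _ => Real.log B) θ := by
    intro θ
    by_cases hθ : θ ∈ S
    · rw [indicator_of_mem hθ, posLog_eq_log (by
        rw [abs_norm]; exact le_of_lt hθ)]
      exact Real.log_le_log (lt_trans one_pos hθ) (hgB _ (hcirc θ))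
    · rw [indicator_of_notMem hθ]
      refine (posLog_eq_zero_iff _).2 ?_ |>.le
      rw [abs_norm]
      exact not_lt.1 hθ
  have hint1 : IntervalIntegrable (fun θ => log⁺ ‖g (circleMap 0 1 θ)‖) volume 0 (2 * π) := by
    have : MeromorphicOn g (sphere 0 |(1 : ℝ)|) := by
      rw [abs_one]
      exact (hg.mono sphere_subset_closedBall).meromorphicOn
    exact this.circleIntegrable_posLog_norm
  have hfin : volume (S ∩ Ioc 0 (2 * π)) ≠ ⊤ := ne_top_of_le_ne_top ENNReal.ofReal_ne_top hvol
  have havg : circleAverage (fun z => log⁺ ‖g z‖) 0 1 ≤ Real.log B / 2 := by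
    have h2pi : (0 : ℝ) ≤ 2 * π := by positivity
    rw [circleAverage_def, intervalIntegral.integral_of_le h2pi, smul_eq_mul]
    have h1 : ∫ θ in Ioc 0 (2 * π), log⁺ ‖g (circleMap 0 1 θ)‖ ≤
        ∫ θ in Ioc 0 (2 * π), S.indicator (fun _ => Real.log B) θ := by
      refine setIntegral_mono hint1.1 ?_ hpt
      exact (integrable_const _).indicator hSm
    have h2 : ∫ θ in Ioc 0 (2 * π), S.indicator (fun _ => Real.log B) θ ≤ π * Real.log B := by
      rw [integral_indicator hSm, setIntegral_const, smul_eq_mul]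
      refine mul_le_mul_of_nonneg_right ?_ hlogB
      rw [measureReal_def, Measure.restrict_apply hSm]
      exact ENNReal.toReal_le_of_le_ofReal pi_pos.le hvol
    calc (2 * π)⁻¹ * ∫ θ in Ioc 0 (2 * π), log⁺ ‖g (circleMap 0 1 θ)‖
        ≤ (2 * π)⁻¹ * (π * Real.log B) := by gcongr; exact h1.trans h2
      _ = Real.log B / 2 := by field_simp
  have := (log_norm_le_circleAverage_posLog hg).trans havg
  have hg0 : 0 < ‖g 0‖ := norm_pos_iff.2 h0
  rw [← Real.log_le_log_iff (by positivity) hBpos, Real.log_pow]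
  push_cast
  linarith

variable {E : Type*} [NormedAddCommGroup E] [NormedSpace ℂ E] [FiniteDimensional ℂ E]
  [MeasurableSpace E] [BorelSpace E]

/-- The push-forward is again a Haar measure, hence a multiple of `μ`; the unit ball is preserved,
so the multiple is `1`. -/
theorem addHaar_preimage_circle_smul (μ : Measure E) [μ.IsAddHaarMeasure] {u : ℂ} (hu : ‖u‖ = 1)
    {N : Set E} (hN : MeasurableSet N) : μ ((fun w => u • w) ⁻¹' N) = μ N := by
  have : ProperSpace E := FiniteDimensional.proper ℂ E
  have hu0 : u ≠ 0 := by rintro rfl; simp at hu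
  let T : E ≃L[ℂ] E := ContinuousLinearEquiv.smulLeft (Units.mk0 u hu0)
  have hT : ∀ w, T w = u • w := fun w => rfl
  have hTe : (fun w => u • w) = T := funext fun w => (hT w).symm
  have hmeas : Measurable (T : E → E) := T.continuous.measurable
  have hhaar : (μ.map T).IsAddHaarMeasure := T.isAddHaarMeasure_map μ
  have hsm := Measure.isAddLeftInvariant_eq_smul (μ.map T) μ
  have hball : (T : E → E) ⁻¹' ball 0 1 = ball 0 1 := by
    ext w
    simp [hT, norm_smul, hu]
  have hone : (μ.map T).addHaarScalarFactor μ = 1 := by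
    have h1 : (μ.map T) (ball 0 1) = μ (ball 0 1) := by
      rw [Measure.map_apply hmeas measurableSet_ball, hball]
    rw [hsm, Measure.smul_apply] at h1
    have hpos : μ (ball (0 : E) 1) ≠ 0 := (measure_ball_pos μ 0 one_pos).ne'
    have hfin : μ (ball (0 : E) 1) ≠ ⊤ := measure_ball_lt_top.ne
    have h2 : (((μ.map T).addHaarScalarFactor μ : NNReal) : ENNReal) * μ (ball 0 1)
      = 1 * μ (ball 0 1) := by rw [one_mul]; exact h1
    exact_mod_cast (ENNReal.mul_left_inj hpos hfin).1 h2
  rw [hone, one_smul] at hsm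
  rw [hTe, ← Measure.map_apply hmeas hN, hsm]

/-- By Fubini and rotation invariance, the measure of bad angles on the circle through `w`, averaged
over `w` in the ball, is at most `π`. Some `w` does no worse than average, and the one-variable
estimate applies on the disc `x + z • w`. -/
theorem norm_sq_le_of_measure_le (μ : Measure E) [μ.IsAddHaarMeasure] {G : E → ℂ} {x : E} {ρ : ℝ}
    (hρ : 0 < ρ) (hG : DifferentiableOn ℂ G (ball x ρ)) {B : ℝ} (hB : 1 ≤ B)
    (hGB : ∀ y ∈ ball x ρ, ‖G y‖ ≤ B)
    (hμ : 2 * μ {w ∈ ball (0 : E) ρ | 1 < ‖G (x + w)‖} ≤ μ (ball (0 : E) ρ)) :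
    ‖G x‖ ^ 2 ≤ B := by
  have : ProperSpace E := FiniteDimensional.proper ℂ E
  have hmem : ∀ {w : E}, w ∈ ball (0 : E) ρ → x + w ∈ ball x ρ := by
    intro w hw
    simpa [mem_ball, dist_eq_norm] using hw
  set N : Set E := {w ∈ ball (0 : E) ρ | 1 < ‖G (x + w)‖} with hN
  have hNo : IsOpen N := by
    have hc : ContinuousOn (fun w => ‖G (x + w)‖) (ball (0 : E) ρ) :=
      (hG.continuousOn.comp (by fun_prop) fun w hw => hmem hw).norm
    exact hc.isOpen_inter_preimage isOpen_ball isOpen_Ioi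
  have hNm := hNo.measurableSet
  let I : Measure ℝ := volume.restrict (Ioc 0 (2 * π))
  let P : Set (E × ℝ) := (fun p : E × ℝ => circleMap 0 1 p.2 • p.1) ⁻¹' N
  have hPo : IsOpen P := hNo.preimage (by fun_prop)
  have hPm : MeasurableSet P := hPo.measurableSet
  let f : E → ENNReal := fun w => I (Prod.mk w ⁻¹' P)
  have hfm : Measurable f := measurable_measure_prodMk_left hPm
  have hnorm : ∀ θ, ‖circleMap 0 1 θ‖ = 1 := fun θ => by simp
  have hint : ∫⁻ w in ball (0 : E) ρ, f w ∂μ = μ N * ENNReal.ofReal (2 * π) := by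
    have h1 : ∫⁻ w in ball (0 : E) ρ, f w ∂μ = ((μ.restrict (ball 0 ρ)).prod I) P :=
      (Measure.prod_apply hPm).symm
    rw [h1, Measure.prod_apply_symm hPm]
    have h2 : ∀ θ, (μ.restrict (ball 0 ρ)) ((fun w => (w, θ)) ⁻¹' P) = μ N := by
      intro θ
      have hm : MeasurableSet ((fun w : E => (w, θ)) ⁻¹' P) := measurable_prodMk_right hPm
      rw [Measure.restrict_apply hm, ← addHaar_preimage_circle_smul μ (hnorm θ) hNm]
      congr 1
      ext w
      simp only [P, mem_inter_iff, mem_preimage]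
      refine ⟨fun h => h.1, fun h => ⟨h, ?_⟩⟩
      have := h.1
      simpa [norm_smul] using this
    simp only [h2, lintegral_const, I, Measure.restrict_apply_univ, Real.volume_Ioc, sub_zero]
  have hb0 : μ (ball (0 : E) ρ) ≠ 0 := (measure_ball_pos μ 0 hρ).ne'
  have hbt : μ (ball (0 : E) ρ) ≠ ⊤ := measure_ball_lt_top.ne
  obtain ⟨w, hw, hfw⟩ := exists_le_setLAverage hb0 hbt hfm.aemeasurable
  have hfw' : f w ≤ ENNReal.ofReal π := by
    refine hfw.trans ?_
    rw [setLAverage_eq, hint]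
    refine ENNReal.div_le_of_le_mul ?_
    rw [ENNReal.ofReal_mul zero_le_two, ENNReal.ofReal_ofNat]
    calc μ N * (2 * ENNReal.ofReal π) = ENNReal.ofReal π * (2 * μ N) := by ring
      _ ≤ _ := by gcongr
  have hline : ∀ z ∈ closedBall (0 : ℂ) 1, x + z • w ∈ ball x ρ := by
    intro z hz
    refine hmem ?_
    rw [mem_ball_zero_iff] at hw ⊢
    rw [mem_closedBall_zero_iff] at hz
    rw [norm_smul]
    nlinarith [norm_nonneg w]
  have han : AnalyticOnNhd ℂ (fun z : ℂ => G (x + z • w)) (closedBall 0 1) := by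
    have ho : IsOpen ((fun z : ℂ => x + z • w) ⁻¹' ball x ρ) := isOpen_ball.preimage (by fun_prop)
    have hd : DifferentiableOn ℂ (fun z : ℂ => G (x + z • w))
        ((fun z : ℂ => x + z • w) ⁻¹' ball x ρ) :=
      hG.comp (by fun_prop) fun z hz => hz
    exact (hd.analyticOnNhd ho).mono hline
  have key := norm_sq_le_of_volume_le han hB
    (fun z hz => hGB _ (hline z (sphere_subset_closedBall hz))) ?_
  · simpa using key
  · refine le_trans ?_ hfw'
    have hm : MeasurableSet (Prod.mk w ⁻¹' P) := measurable_prodMk_left hPm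
    simp only [f, I]
    rw [Measure.restrict_apply hm]
    refine measure_mono (inter_subset_inter_left _ fun θ hθ => ?_)
    refine ⟨?_, hθ⟩
    simpa [norm_smul] using hw

end SubmeanValue

/-! ### From weak to strong holomorphy under a local bound -/

section WeakHolomorphy

open Metric Set Filter Topology InnerProductSpace

variable {E : Type*} [NormedAddCommGroup E] [NormedSpace ℂ E]
  {F : Type*} [NormedAddCommGroup F] [InnerProductSpace ℂ F]

/-- A Schwarz lemma of order two: the first-order remainder is bounded by `4 * C` and is `o(‖x -
a‖)`. The constants depend on `f` only through `C`, which makes the estimate uniform over families.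
-/
theorem norm_sub_sub_fderiv_le {f : E → ℂ} {a : E} {ρ C : ℝ} (hρ : 0 < ρ)
    (hf : DifferentiableOn ℂ f (ball a ρ)) (hC : ∀ x ∈ ball a ρ, ‖f x‖ ≤ C) :
    ‖fderiv ℂ f a‖ ≤ 2 * C / ρ ∧
      ∀ x ∈ ball a ρ, ‖f x - f a - fderiv ℂ f a (x - a)‖ ≤ 4 * C * (dist x a / ρ) ^ 2 := by
  have ha : a ∈ ball a ρ := mem_ball_self hρ
  have hsub : ∀ x ∈ ball a ρ, ‖f x - f a‖ ≤ 2 * C := fun x hx => by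
    linarith [norm_sub_le (f x) (f a), hC x hx, hC a ha]
  have hD : ‖fderiv ℂ f a‖ ≤ 2 * C / ρ := by
    refine Complex.norm_fderiv_le_div_of_mapsTo_ball hf (fun x hx => ?_) hρ
    rw [mem_closedBall, dist_eq_norm]
    exact hsub x hx
  refine ⟨hD, fun x hx => ?_⟩
  let g : E → ℂ := fun x => f x - f a - fderiv ℂ f a (x - a)
  have hga : g a = 0 := by simp [g]
  have hg : DifferentiableOn ℂ g (ball a ρ) := by
    refine (hf.sub_const _).sub ?_
    fun_prop
  have hmaps : MapsTo g (ball a ρ) (closedBall (g a) (4 * C)) := by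
    intro y hy
    rw [mem_closedBall, hga, dist_zero_right]
    have h1 : ‖fderiv ℂ f a (y - a)‖ ≤ 2 * C := by
      refine ((fderiv ℂ f a).le_opNorm _).trans ?_
      have hy' : ‖y - a‖ ≤ ρ := by
        rw [← dist_eq_norm]; exact (mem_ball.1 hy).le
      calc ‖fderiv ℂ f a‖ * ‖y - a‖ ≤ 2 * C / ρ * ρ := by
            refine mul_le_mul hD hy' (norm_nonneg _) ((norm_nonneg _).trans hD)
        _ = 2 * C := by field_simp
    linarith [norm_sub_le (f y - f a) (fderiv ℂ f a (y - a)), hsub y hy]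
  have ho : (g · - g a) =o[𝓝 a] (fun w ↦ ‖w - a‖ ^ 1) := by
    have h := ((hf.differentiableAt (ball_mem_nhds a hρ)).hasFDerivAt).isLittleO
    simp only [hga, sub_zero, pow_one]
    exact h.norm_right
  have := Complex.dist_le_mul_div_pow_of_mapsTo_ball_of_isLittleO hg hmaps ho hx
  rw [hga, dist_zero_right] at this
  exact this

variable [CompleteSpace F]

/-- A locally bounded map into a Hilbert space which is weakly antiholomorphic when tested against a
total set of vectors is antiholomorphic. -/
theorem differentiableAt_toDual {k : E → F} {Y : Set E} {a : E} {ρ C : ℝ} (hρ : 0 < ρ)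
    (hdense : DenseRange (Finsupp.linearCombination ℂ (fun y : Y => k y)))
    (hk : ∀ y ∈ Y, DifferentiableOn ℂ (fun x => inner ℂ (k x) (k y)) (ball a ρ))
    (hC : ∀ x ∈ ball a ρ, ‖k x‖ ≤ C) :
    DifferentiableAt ℂ (fun x => toDual ℂ F (k x)) a := by
  set e := Finsupp.linearCombination ℂ (fun y : Y => k y) with he
  let f : (Y →₀ ℂ) → E → ℂ := fun c x => inner ℂ (k x) (e c)
  have hC0 : 0 ≤ C := (norm_nonneg _).trans (hC a (mem_ball_self hρ))
  have hf : ∀ c, DifferentiableOn ℂ (f c) (ball a ρ) := by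
    intro c
    have : f c = fun x => ∑ y ∈ c.support, c y * inner ℂ (k x) (k y) := by
      funext x
      simp only [f, he, Finsupp.linearCombination_apply, Finsupp.sum, inner_sum, inner_smul_right]
    rw [this]
    exact DifferentiableOn.fun_sum fun y _ => (hk y y.2).const_mul _
  have hfa : ∀ c, DifferentiableAt ℂ (f c) a := fun c =>
    (hf c).differentiableAt (ball_mem_nhds a hρ)
  have hfC : ∀ c, ∀ x ∈ ball a ρ, ‖f c x‖ ≤ C * ‖e c‖ := fun c x hx =>
    (norm_inner_le_norm _ _).trans (by gcongr; exact hC x hx)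
  let A : (Y →₀ ℂ) →ₗ[ℂ] (E →L[ℂ] ℂ) :=
    { toFun := fun c => fderiv ℂ (f c) a
      map_add' := fun c d => by
        have : f (c + d) = f c + f d := by
          funext x; simp [f]
        rw [this, fderiv_add (hfa c) (hfa d)]
      map_smul' := fun z c => by
        have : f (z • c) = z • f c := by
          funext x; simp [f]
        rw [this, fderiv_const_smul (hfa c), RingHom.id_apply] }
  have hA : ∀ c, ‖A c‖ ≤ 2 * C / ρ * ‖e c‖ := fun c => by
    have := (norm_sub_sub_fderiv_le hρ (hf c) (hfC c)).1
    calc ‖A c‖ ≤ 2 * (C * ‖e c‖) / ρ := this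
      _ = _ := by ring
  -- The bound `hA` is in terms of `‖e c‖`, so the derivative of the pairing depends only on the
  -- vector `e c` and extends to all of `F`; flipped, it is the candidate derivative of `toDual ∘
  -- k`.
  have hext : ∀ c, A.extendOfNorm e (e c) = A c := fun c =>
    LinearMap.extendOfNorm_eq hdense ⟨_, hA⟩ c
  let D : E →L[ℂ] StrongDual ℂ F := (A.extendOfNorm e).flip
  -- The quadratic remainder bound is uniform over test vectors in a dense set, hence holds in
  -- operator norm.
  have hquad : ∀ x ∈ ball a ρ, ‖toDual ℂ F (k x) - toDual ℂ F (k a) - D (x - a)‖ ≤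
      4 * C * (dist x a / ρ) ^ 2 := by
    intro x hx
    refine ContinuousLinearMap.opNorm_le_bound _ (by positivity) fun v => ?_
    refine isClosed_property (p := fun v => ‖(toDual ℂ F (k x) - toDual ℂ F (k a) - D (x - a)) v‖ ≤
      4 * C * (dist x a / ρ) ^ 2 * ‖v‖) hdense (isClosed_le (by fun_prop) (by fun_prop)) ?_ v
    intro c
    have h := (norm_sub_sub_fderiv_le hρ (hf c) (hfC c)).2 x hx
    have : (toDual ℂ F (k x) - toDual ℂ F (k a) - D (x - a)) (e c) =
        f c x - f c a - fderiv ℂ (f c) a (x - a) := by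
      simp only [sub_apply, toDual_apply_apply, D,
        ContinuousLinearMap.flip_apply, hext]
      rfl
    rw [this]
    refine h.trans_eq (by ring)
  have hO : (fun x => toDual ℂ F (k x) - toDual ℂ F (k a) - D (x - a)) =O[𝓝 a]
      fun x => ‖x - a‖ ^ 2 := by
    refine Asymptotics.IsBigO.of_bound (4 * C / ρ ^ 2) ?_
    filter_upwards [ball_mem_nhds a hρ] with x hx
    refine (hquad x hx).trans_eq ?_
    rw [dist_eq_norm, norm_pow, norm_norm]
    ring
  have h0 := hO.hasFDerivAt (𝕜 := ℂ) (by norm_num : 1 < 2)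
  have h1 := h0.differentiableAt.add
    (f := fun x => toDual ℂ F (k x) - toDual ℂ F (k a) - D (x - a))
    (g := fun x => toDual ℂ F (k a) + D (x - a)) (by fun_prop)
  refine h1.congr_of_eventuallyEq (Eventually.of_forall fun x => ?_)
  simp

end WeakHolomorphy

/-! ### Enlarging a ball of boundedness through Taylor coefficients -/

section Hartogs

open Metric Set Filter Topology InnerProductSpace MeasureTheory

theorem clm_inv_factorial_smul_iteratedDeriv {V : Type*} [NormedAddCommGroup V] [NormedSpace ℂ V]
    [CompleteSpace V] {ψ : ℂ → V} (hψ : AnalyticAt ℂ ψ 0) (T : V →L[ℂ] ℂ) (m : ℕ) :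
    T ((m.factorial : ℂ)⁻¹ • iteratedDeriv m ψ 0) =
      (m.factorial : ℂ)⁻¹ • iteratedDeriv m (fun z => T (ψ z)) 0 := by
  have h := T.iteratedFDeriv_comp_left (n := m) (i := m) hψ.contDiffAt le_rfl
  rw [map_smul, iteratedDeriv_eq_iteratedFDeriv, iteratedDeriv_eq_iteratedFDeriv]
  change _ = _ • (iteratedFDeriv ℂ m (T ∘ ψ) 0) fun _ => 1
  rw [h]
  rfl

theorem norm_inv_factorial_smul_iteratedDeriv_le {V : Type*} [NormedAddCommGroup V]
    [NormedSpace ℂ V] [CompleteSpace V] {ψ : ℂ → V} {R B : ℝ} (hR : 0 < R)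
    (hψ : DiffContOnCl ℂ ψ (ball 0 R)) (hB : ∀ z ∈ sphere (0 : ℂ) R, ‖ψ z‖ ≤ B) (m : ℕ) :
    ‖(m.factorial : ℂ)⁻¹ • iteratedDeriv m ψ 0‖ ≤ B / R ^ m := by
  have h := Complex.norm_iteratedDeriv_le_of_forall_mem_sphere_norm_le m hR hψ hB
  have hm : (0 : ℝ) < m.factorial := by positivity
  rw [norm_smul, norm_inv, Complex.norm_natCast, inv_mul_le_iff₀ hm]
  exact h.trans_eq (by ring)

variable {E : Type*} [NormedAddCommGroup E] [NormedSpace ℂ E]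
  {F : Type*} [NormedAddCommGroup F] [InnerProductSpace ℂ F]

theorem continuousOn_inner_swap {k : E → F} {X : Set E}
    (hk : ∀ y ∈ X, DifferentiableOn ℂ (fun x => inner ℂ (k x) (k y)) X) {y : E} (hy : y ∈ X) :
    ContinuousOn (fun x => ‖(inner ℂ (k y) (k x) : ℂ)‖) X := by
  refine (hk y hy).continuousOn.norm.congr fun x _ => ?_
  exact norm_inner_symm _ _

theorem exists_nat_norm_inner_le {k : E → F} {X S : Set E} (hS : IsCompact S) (hSX : S ⊆ X)
    (hk : ∀ y ∈ X, DifferentiableOn ℂ (fun x => inner ℂ (k x) (k y)) X) {x : E} (hx : x ∈ X) :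
    ∃ M : ℕ, ∀ y ∈ S, ‖(inner ℂ (k y) (k x) : ℂ)‖ ≤ M := by
  obtain ⟨C, hC⟩ := hS.exists_bound_of_continuousOn ((hk x hx).continuousOn.mono hSX)
  obtain ⟨M, hM⟩ := exists_nat_ge C
  exact ⟨M, fun y hy => (hC y hy).trans hM⟩

theorem hasSum_strongDual_apply {c : ℕ → StrongDual ℂ F} {S : StrongDual ℂ F} (h : HasSum c S)
    (f : F) : HasSum (fun m => c m f) (S f) :=
  h.map (ContinuousLinearMap.apply ℂ ℂ f) (ContinuousLinearMap.apply ℂ ℂ f).continuous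

/-- The coefficients are dominated by a geometric series of sum `4 * A`, so they sum in norm to a
functional; it agrees with `w` on a total set, hence everywhere. This bounds `k x` at points where
only its pairings are known to be holomorphic. -/
theorem norm_le_of_hasSum_inner {ι : Type*} [CompleteSpace F] {e : ι → F}
    (hdense : DenseRange (Finsupp.linearCombination ℂ e)) {w : F} {c : ℕ → StrongDual ℂ F} {A : ℝ}
    (hc : ∀ m, ‖c m‖ ≤ A * (3 / 4) ^ m)
    (hs : ∀ i, HasSum (fun m => c m (e i)) (inner ℂ w (e i))) : ‖w‖ ≤ A * 4 := by
  have hgeo : HasSum (fun m : ℕ => A * (3 / 4 : ℝ) ^ m) (A * 4) := by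
    have := (hasSum_geometric_of_lt_one (r := (3 / 4 : ℝ)) (by norm_num) (by norm_num)).mul_left A
    norm_num at this
    exact this
  have hsum : Summable c := Summable.of_norm_bounded hgeo.summable hc
  have hnorm : ‖∑' m, c m‖ ≤ A * 4 := tsum_of_norm_bounded hgeo hc
  have heq : ∑' m, c m = toDual ℂ F w := by
    refine ContinuousLinearMap.ext fun f => ?_
    refine isClosed_property (p := fun f => (∑' m, c m) f = toDual ℂ F w f) hdense
      (isClosed_eq (by fun_prop) (by fun_prop)) (fun q => ?_) f
    have hker : ∀ i, (∑' m, c m) (e i) = toDual ℂ F w (e i) := fun i =>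
      (hasSum_strongDual_apply hsum.hasSum (e i)).unique (hs i)
    simp only [Finsupp.linearCombination_apply, Finsupp.sum, map_sum, map_smul, hker]
  rw [heq, LinearIsometryEquiv.norm_map] at hnorm
  exact hnorm

variable [FiniteDimensional ℂ E]

/-- For each fixed `x` the pairing is bounded on the compact set `S`, so the exceptional sets
decrease to `∅` as `M` grows, and continuity of the measure applies. -/
theorem exists_measure_lt_of_inner [MeasurableSpace E] [BorelSpace E] (μ : Measure E)
    [μ.IsAddHaarMeasure] {k : E → F} {X S : Set E} (hS : IsCompact S) (hSX : S ⊆ X)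
    (hk : ∀ y ∈ X, DifferentiableOn ℂ (fun x => inner ℂ (k x) (k y)) X)
    {b : E} {s : ℝ} (hs : ball b s ⊆ X) {ε : ENNReal} (hε : 0 < ε) :
    ∃ M : ℕ, 1 ≤ M ∧
      μ {x ∈ ball b s | ∃ y ∈ S, (M : ℝ) < ‖(inner ℂ (k y) (k x) : ℂ)‖} < ε := by
  have : ProperSpace E := FiniteDimensional.proper ℂ E
  let N : ℕ → Set E := fun M =>
    {x ∈ ball b s | ∃ y ∈ S, (M : ℝ) < ‖(inner ℂ (k y) (k x) : ℂ)‖}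
  have hNo : ∀ M, IsOpen (N M) := by
    intro M
    have : N M = ⋃ y ∈ S, (ball b s ∩ (fun x => ‖(inner ℂ (k y) (k x) : ℂ)‖) ⁻¹' Ioi (M : ℝ)) := by
      ext x
      simp only [N, mem_ofPred_eq, mem_iUnion, mem_inter_iff, mem_preimage, mem_Ioi, exists_prop]
      tauto
    rw [this]
    refine isOpen_biUnion fun y hy => ?_
    exact ((continuousOn_inner_swap hk (hSX hy)).mono hs).isOpen_inter_preimage isOpen_ball
      isOpen_Ioi
  have hanti : Antitone N := by
    intro M M' hMM x hx
    obtain ⟨hx, y, hy, hlt⟩ := hx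
    exact ⟨hx, y, hy, lt_of_le_of_lt (by exact_mod_cast hMM) hlt⟩
  have hempty : ⋂ M, N M = ∅ := by
    refine eq_empty_iff_forall_notMem.2 fun x hx => ?_
    rw [mem_iInter] at hx
    obtain ⟨M, hM⟩ := exists_nat_norm_inner_le hS hSX hk (hs (hx 0).1)
    obtain ⟨_, y, hy, hlt⟩ := hx M
    exact absurd (hM y hy) (not_le.2 hlt)
  have hfin : μ (N 0) ≠ ⊤ :=
    ne_top_of_le_ne_top (measure_ball_lt_top (μ := μ) (x := b) (r := s)).ne
      (measure_mono fun x hx => hx.1)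
  have htend := tendsto_measure_iInter_atTop (μ := μ)
    (fun M => (hNo M).measurableSet.nullMeasurableSet) hanti ⟨0, hfin⟩
  rw [hempty, measure_empty] at htend
  obtain ⟨M, hM1, hM2⟩ := ((eventually_ge_atTop 1).and (htend.eventually (gt_mem_nhds hε))).exists
  exact ⟨M, hM1, hM2⟩

variable [CompleteSpace F]

set_option maxHeartbeats 400000 in
/-- A bound for a sesquiholomorphic kernel on a small ball propagates to a ball of larger radius
inside its domain. -/
theorem exists_bound_of_bound_ball {k : E → F} {X : Set E}
    (hdense : DenseRange (Finsupp.linearCombination ℂ (fun y : X => k y)))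
    (hk : ∀ y ∈ X, DifferentiableOn ℂ (fun x => inner ℂ (k x) (k y)) X)
    {b : E} {s t C : ℝ} (hs : 0 < s) (hst : s < t) (htX : ball b t ⊆ X)
    (hX : closedBall b (64 * s) ⊆ X) (hC : ∀ x ∈ ball b t, ‖k x‖ ≤ C) :
    ∃ C', ∀ x ∈ closedBall b (3 / 2 * s), ‖k x‖ ≤ C' := by
  borelize E
  have : ProperSpace E := FiniteDimensional.proper ℂ E
  let μ : Measure E := Measure.addHaar
  wlog hC1 : 1 ≤ C generalizing C
  · exact this (C := max C 1) (fun x hx => (hC x hx).trans (le_max_left _ _)) (le_max_right _ _)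
  have hC0 : 0 < C := by linarith
  have hR : (0 : ℝ) < 64 * s := by positivity
  let κ : E → StrongDual ℂ F := fun x => toDual ℂ F (k x)
  have hκ : DifferentiableOn ℂ κ (ball b t) := by
    intro x hx
    obtain ⟨ρ, hρ, hsub⟩ := Metric.isOpen_iff.1 isOpen_ball x hx
    exact (differentiableAt_toDual hρ hdense (fun y hy => (hk y hy).mono (hsub.trans htX))
      fun y hy => hC y (hsub hy)).differentiableWithinAt
  have hsX : ball b s ⊆ X := (ball_subset_ball hst.le).trans htX
  have hhalf : 0 < μ (ball (0 : E) (s / 2)) / 2 :=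
    ENNReal.half_pos (measure_ball_pos μ 0 (by positivity)).ne'
  obtain ⟨M, hM1, hM⟩ := exists_measure_lt_of_inner μ (isCompact_closedBall b (64 * s)) hX hk hsX
    hhalf
  set N := {x ∈ ball b s | ∃ y ∈ closedBall b (64 * s), (M : ℝ) < ‖(inner ℂ (k y) (k x) : ℂ)‖}
    with hN
  have hM1' : (1 : ℝ) ≤ M := by exact_mod_cast hM1
  have hM0 : (0 : ℝ) < M := by linarith
  -- the Taylor coefficients of `κ` along a line through `b`
  have hline : ∀ v : E, ‖v‖ ≤ 1 → ∀ {r : ℝ} {z : ℂ}, ‖z‖ ≤ r → b + z • v ∈ closedBall b r := by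
    intro v hv r z hz
    rw [mem_closedBall, dist_eq_norm, add_sub_cancel_left, norm_smul]
    nlinarith [norm_nonneg z, norm_nonneg v]
  have hline' : ∀ v : E, ‖v‖ ≤ 1 → ∀ {r : ℝ} {z : ℂ}, ‖z‖ < r → b + z • v ∈ ball b r := by
    intro v hv r z hz
    rw [mem_ball, dist_eq_norm, add_sub_cancel_left, norm_smul]
    nlinarith [norm_nonneg z, norm_nonneg v]
  let c : E → ℕ → StrongDual ℂ F := fun v m =>
    (m.factorial : ℂ)⁻¹ • iteratedDeriv m (fun z : ℂ => κ (b + z • v)) 0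
  have hψd : ∀ v : E, ‖v‖ ≤ 1 → DifferentiableOn ℂ (fun z : ℂ => κ (b + z • v)) (ball 0 t) := by
    intro v hv
    refine hκ.comp (by fun_prop) fun z hz => hline' v hv (by simpa using hz)
  have hψa : ∀ v : E, ‖v‖ ≤ 1 → AnalyticAt ℂ (fun z : ℂ => κ (b + z • v)) 0 := fun v hv =>
    (hψd v hv).analyticAt (ball_mem_nhds 0 (hs.trans hst))
  have hψc : ∀ v : E, ‖v‖ ≤ 1 → ∀ r < t, DiffContOnCl ℂ (fun z : ℂ => κ (b + z • v)) (ball 0 r) :=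
    fun v hv r hr => ((hψd v hv).mono (closedBall_subset_ball hr)).diffContOnCl_ball subset_rfl
  have happ : ∀ v : E, ‖v‖ ≤ 1 → ∀ m (f : F), c v m f =
      (m.factorial : ℂ)⁻¹ • iteratedDeriv m (fun z : ℂ => (inner ℂ (k (b + z • v)) f : ℂ)) 0 :=
    fun v hv m f => clm_inv_factorial_smul_iteratedDeriv (hψa v hv)
      (ContinuousLinearMap.apply ℂ ℂ f) m
  have hkd : ∀ v : E, ‖v‖ ≤ 1 → ∀ y ∈ X,
      DifferentiableOn ℂ (fun z : ℂ => (inner ℂ (k (b + z • v)) (k y) : ℂ))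
        (closedBall 0 (64 * s)) := by
    intro v hv y hy
    refine (hk y hy).comp (by fun_prop) fun z hz => hX (hline v hv (by simpa using hz))
  -- Off `N`, Cauchy's estimate is available on the large radius `64 * s`; `hc0` below is the crude
  -- estimate on radius `s`, free of exceptions.
  have hcX : ∀ v : E, ‖v‖ ≤ 1 → ∀ m, ∀ x ∈ ball b s, x ∉ N →
      ‖c v m (k x)‖ ≤ M / (64 * s) ^ m := by
    intro v hv m x hx hxN
    rw [happ v hv]
    refine norm_inv_factorial_smul_iteratedDeriv_le hR
      ((hkd v hv x (hsX hx)).diffContOnCl_ball subset_rfl) (fun z hz => ?_) m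
    by_contra hlt
    exact hxN ⟨hx, _, hline v hv (by simpa using (mem_sphere_zero_iff_norm.1 hz).le), not_le.1 hlt⟩
  have hc0 : ∀ v : E, ‖v‖ ≤ 1 → ∀ m, ‖c v m‖ ≤ C / s ^ m := by
    intro v hv m
    refine norm_inv_factorial_smul_iteratedDeriv_le hs (hψc v hv s hst) (fun z hz => ?_) m
    rw [LinearIsometryEquiv.norm_map]
    exact hC _ (hline' v hv ((mem_sphere_zero_iff_norm.1 hz).le.trans_lt hst))
  have hc2 : ∀ v : E, ‖v‖ ≤ 1 → ∀ m, ‖c v m‖ ≤ C * M / (2 * s) ^ m := by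
    intro v hv m
    set h : F := (toDual ℂ F).symm (c v m) with hh
    have hhn : ‖h‖ = ‖c v m‖ := LinearIsometryEquiv.norm_map _ _
    have hch : ∀ f, c v m f = inner ℂ h f := fun f => by
      rw [hh, toDual_symm_apply]
    -- The submean estimate removes `N` by taking a geometric mean of the two bounds: the good
    -- radius `64 * s` and the crude radius `s` combine to `8 * s`.
    have hx : ∀ x ∈ closedBall b (s / 2), ‖(inner ℂ (k x) h : ℂ)‖ ≤ C * M / (8 * s) ^ m := by
      intro x hx
      have hsub : ball x (s / 2) ⊆ ball b s := by
        refine ball_subset_ball' ?_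
        rw [mem_closedBall] at hx
        linarith
      let G : E → ℂ := fun y => ((64 * s) ^ m / M : ℝ) * inner ℂ (k y) h
      have hG : DifferentiableOn ℂ G (ball x (s / 2)) := by
        refine DifferentiableOn.const_mul ?_ _
        have : DifferentiableOn ℂ (fun y => κ y h) (ball b t) := hκ.clm_apply (by fun_prop)
        exact this.mono (hsub.trans (ball_subset_ball hst.le))
      have hGn : ∀ y, ‖G y‖ = (64 * s) ^ m / M * ‖(inner ℂ (k y) h : ℂ)‖ := fun y => by
        simp only [G]
        rw [norm_mul, Complex.norm_real, Real.norm_of_nonneg (by positivity)]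
      have hGB : ∀ y ∈ ball x (s / 2), ‖G y‖ ≤ (C * 8 ^ m) ^ 2 := by
        intro y hy
        rw [hGn]
        have h1 : ‖(inner ℂ (k y) h : ℂ)‖ ≤ C * (C / s ^ m) := by
          refine (norm_inner_le_norm _ _).trans ?_
          rw [hhn]
          exact mul_le_mul (hC y (ball_subset_ball hst.le (hsub hy))) (hc0 v hv m)
            (norm_nonneg _) hC0.le
        have h2 : (64 * s) ^ m / M ≤ (64 * s) ^ m :=
          div_le_self (by positivity) hM1'
        calc (64 * s) ^ m / M * ‖(inner ℂ (k y) h : ℂ)‖ ≤ (64 * s) ^ m * (C * (C / s ^ m)) := by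
              gcongr
          _ = (C * 8 ^ m) ^ 2 := by
              rw [mul_pow, mul_pow, ← pow_mul, mul_comm m 2, pow_mul]
              norm_num
              field_simp
      have hB1 : 1 ≤ (C * 8 ^ m) ^ 2 := by
        refine one_le_pow₀ ?_
        exact one_le_mul_of_one_le_of_one_le hC1 (one_le_pow₀ (by norm_num))
      have hmeas : 2 * μ {w ∈ ball (0 : E) (s / 2) | 1 < ‖G (x + w)‖} ≤ μ (ball (0 : E) (s / 2)) := by
        have hsubN : {w ∈ ball (0 : E) (s / 2) | 1 < ‖G (x + w)‖} ⊆ (fun w => x + w) ⁻¹' N := by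
          rintro w ⟨hw, hGw⟩
          have hxw : x + w ∈ ball b s := hsub (by simpa [mem_ball, dist_eq_norm] using hw)
          by_contra hn
          have h1 := hcX v hv m _ hxw hn
          rw [hch, norm_inner_symm] at h1
          rw [hGn] at hGw
          have : (64 * s) ^ m / M * ‖(inner ℂ (k (x + w)) h : ℂ)‖ ≤ 1 := by
            calc _ ≤ (64 * s) ^ m / M * (M / (64 * s) ^ m) := by gcongr
              _ = 1 := by field_simp
          linarith
        have h1 := (measure_mono hsubN).trans (measure_preimage_add μ x N).le
        calc 2 * μ {w ∈ ball (0 : E) (s / 2) | 1 < ‖G (x + w)‖}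
            ≤ 2 * (μ (ball (0 : E) (s / 2)) / 2) := by gcongr; exact h1.trans hM.le
          _ = _ := ENNReal.mul_div_cancel two_ne_zero ENNReal.ofNat_ne_top
      have hfin := norm_sq_le_of_measure_le μ (by positivity) hG hB1 hGB hmeas
      have hfin' := (sq_le_sq₀ (norm_nonneg _) (by positivity)).1 hfin
      rw [hGn, div_mul_eq_mul_div, div_le_iff₀ hM0] at hfin'
      rw [le_div_iff₀ (by positivity)]
      have h64 : (64 * s) ^ m = 8 ^ m * (8 * s) ^ m := by
        rw [← mul_pow]; ring_nf
      rw [h64] at hfin'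
      have h8 : (0 : ℝ) < 8 ^ m := by positivity
      nlinarith
    -- `‖c v m‖ ^ 2` is the coefficient tested on its own Riesz vector `h`, that is, a Taylor
    -- coefficient of `⟪k (b + z • v), h⟫`, estimated on radius `s / 2`. Since `8 * s * (s / 2) = (2
    -- * s) ^ 2`, the radius of convergence has doubled.
    have hsq : ‖c v m‖ ^ 2 ≤ C * M / (8 * s) ^ m / (s / 2) ^ m := by
      have h1 : ‖c v m h‖ = ‖c v m‖ ^ 2 := by
        rw [hch, ← hhn, inner_self_eq_norm_sq_to_K]
        simp
      rw [← h1, happ v hv]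
      have hd : DiffContOnCl ℂ (fun z : ℂ => (inner ℂ (k (b + z • v)) h : ℂ)) (ball 0 (s / 2)) := by
        have : DifferentiableOn ℂ (fun z : ℂ => κ (b + z • v) h) (ball 0 t) :=
          (hψd v hv).clm_apply (by fun_prop)
        exact (this.mono (closedBall_subset_ball (by linarith))).diffContOnCl_ball subset_rfl
      refine norm_inv_factorial_smul_iteratedDeriv_le (by positivity) hd (fun z hz => ?_) m
      exact hx _ (hline v hv (mem_sphere_zero_iff_norm.1 hz).le)
    have hCM : 1 ≤ C * M := one_le_mul_of_one_le_of_one_le hC1 hM1'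
    have h3 : C * M / (8 * s) ^ m / (s / 2) ^ m = C * M / ((2 * s) ^ m) ^ 2 := by
      rw [div_div, ← mul_pow, ← pow_mul, mul_comm m 2, pow_mul]
      ring_nf
    rw [h3] at hsq
    refine (sq_le_sq₀ (norm_nonneg _) (by positivity)).1 (hsq.trans ?_)
    rw [div_pow]
    gcongr
    nlinarith
  refine ⟨C * M * 4, fun x hx => ?_⟩
  -- write `x = b + z • v` with `‖v‖ ≤ 1`
  obtain ⟨v, hv, z, hz, rfl⟩ : ∃ v : E, ‖v‖ ≤ 1 ∧ ∃ z : ℂ, ‖z‖ ≤ 3 / 2 * s ∧ x = b + z • v := by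
    rw [mem_closedBall, dist_eq_norm] at hx
    rcases eq_or_ne (x - b) 0 with h0 | h0
    · exact ⟨0, by simp, 0, by simp; positivity, by simpa using sub_eq_zero.1 h0⟩
    · have hn : (‖x - b‖ : ℂ) ≠ 0 := by simpa using h0
      refine ⟨(‖x - b‖ : ℂ)⁻¹ • (x - b), ?_, (‖x - b‖ : ℂ), by simpa using hx, ?_⟩
      · rw [norm_smul, norm_inv, Complex.norm_real, norm_norm, inv_mul_cancel₀]
        simpa using h0
      · rw [smul_inv_smul₀ hn]; simp
  have hbd : ∀ m, ‖z ^ m • c v m‖ ≤ C * M * (3 / 4) ^ m := by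
    intro m
    rw [norm_smul, norm_pow]
    calc ‖z‖ ^ m * ‖c v m‖ ≤ (3 / 2 * s) ^ m * (C * M / (2 * s) ^ m) := by
          gcongr
          exact hc2 v hv m
      _ = C * M * ((3 / 2 * s) / (2 * s)) ^ m := by rw [div_pow]; ring
      _ = _ := by
          congr 2
          field_simp
          norm_num
  refine norm_le_of_hasSum_inner hdense hbd fun y => ?_
  -- The scalar pairings are holomorphic up to radius `64 * s`, so their Taylor series converge at
  -- `z` before `k` is known to be bounded there.
  have h2 := Complex.hasSum_taylorSeries_on_ball
    ((hkd v hv y y.2).mono ball_subset_closedBall) (z := z) (by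
      rw [mem_ball_zero_iff]; linarith)
  have hm : ∀ m, (z ^ m • c v m) (k y) = (m.factorial : ℂ)⁻¹ • (z - 0) ^ m •
      iteratedDeriv m (fun z : ℂ => (inner ℂ (k (b + z • v)) (k y) : ℂ)) 0 := fun m => by
    change z ^ m • c v m (k y) = _
    rw [happ v hv, sub_zero, smul_comm]
  simp only [hm]
  exact h2

end Hartogs

/-! ### Local boundedness and holomorphy of the evaluation map -/

section SeparateHolomorphy

open Metric Set Filter Topology InnerProductSpace

variable {E : Type*} [NormedAddCommGroup E] [NormedSpace ℂ E] [FiniteDimensional ℂ E]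
  {F : Type*} [NormedAddCommGroup F] [InnerProductSpace ℂ F]

/-- Baire category: the closed sets where the pairings with the whole ball are at most `m` cover it,
so one has interior; there `‖k y‖ ^ 2 = ⟪k y, k y⟫ ≤ m`. -/
theorem exists_mem_ball_eventually_bounded {k : E → F} {X : Set E} (hXo : IsOpen X)
    (hk : ∀ y ∈ X, DifferentiableOn ℂ (fun x => inner ℂ (k x) (k y)) X) {a : E} (ha : a ∈ X)
    {ε : ℝ} (hε : 0 < ε) : ∃ b ∈ ball a ε, ∃ C, ∀ᶠ y in 𝓝 b, ‖k y‖ ≤ C := by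
  have : ProperSpace E := FiniteDimensional.proper ℂ E
  obtain ⟨ρ, hρ, hρX⟩ := nhds_basis_closedBall.mem_iff.1
    (inter_mem (hXo.mem_nhds ha) (ball_mem_nhds a hε))
  have hSX : closedBall a ρ ⊆ X := hρX.trans inter_subset_left
  let f : ℕ → Set E := fun m =>
    {x ∈ closedBall a ρ | ∀ y ∈ closedBall a ρ, ‖(inner ℂ (k y) (k x) : ℂ)‖ ≤ m}
  have hf : ∀ m, IsClosed (f m) := by
    intro m
    have : f m = closedBall a ρ ∩ ⋂ y ∈ closedBall a ρ,
        (closedBall a ρ ∩ (fun x => ‖(inner ℂ (k y) (k x) : ℂ)‖) ⁻¹' Iic (m : ℝ)) := by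
      ext x
      simp only [f, mem_ofPred_eq, mem_inter_iff, mem_iInter, mem_preimage, mem_Iic]
      exact ⟨fun h => ⟨h.1, fun y hy => ⟨h.1, h.2 y hy⟩⟩, fun h => ⟨h.1, fun y hy => (h.2 y hy).2⟩⟩
    rw [this]
    refine isClosed_closedBall.inter (isClosed_biInter fun y hy => ?_)
    exact ((continuousOn_inner_swap hk (hSX hy)).mono hSX).preimage_isClosed_of_isClosed
      isClosed_closedBall isClosed_Iic
  -- The complement of the ball is added so that Baire's theorem can be used on the whole space `E`.
  have hcl : ∀ m, IsClosed (f m ∪ (ball a ρ)ᶜ) := fun m => (hf m).union isOpen_ball.isClosed_compl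
  have hun : ⋃ m, (f m ∪ (ball a ρ)ᶜ) = univ := by
    refine eq_univ_of_forall fun x => mem_iUnion.2 ?_
    by_cases hx : x ∈ ball a ρ
    · obtain ⟨M, hM⟩ := exists_nat_norm_inner_le (isCompact_closedBall a ρ) hSX hk
        (hSX (ball_subset_closedBall hx))
      exact ⟨M, Or.inl ⟨ball_subset_closedBall hx, hM⟩⟩
    · exact ⟨0, Or.inr hx⟩
  obtain ⟨b, hb, hbρ⟩ := (dense_iUnion_interior_of_closed hcl hun).inter_open_nonempty
    (ball a ρ) isOpen_ball ⟨a, mem_ball_self hρ⟩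
  obtain ⟨m, hm⟩ := mem_iUnion.1 hbρ
  refine ⟨b, (hρX (ball_subset_closedBall hb)).2, √m, ?_⟩
  filter_upwards [isOpen_interior.mem_nhds hm, isOpen_ball.mem_nhds hb] with y hy hyb
  rcases interior_subset hy with h | h
  · have := h.2 y h.1
    rw [inner_self_eq_norm_sq_to_K] at this
    refine Real.le_sqrt_of_sq_le ?_
    simpa using this
  · exact absurd hyb h

variable [CompleteSpace F]

/-- A separately sesquiholomorphic positive kernel is locally bounded. -/
theorem eventually_bounded_of_separately {k : E → F} {X : Set E} (hXo : IsOpen X)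
    (hdense : DenseRange (Finsupp.linearCombination ℂ (fun y : X => k y)))
    (hk : ∀ y ∈ X, DifferentiableOn ℂ (fun x => inner ℂ (k x) (k y)) X) {a : E} (ha : a ∈ X) :
    ∃ C, ∀ᶠ y in 𝓝 a, ‖k y‖ ≤ C := by
  have : ProperSpace E := FiniteDimensional.proper ℂ E
  by_contra hna
  let Ω : Set E := {x | ∃ C, ∀ᶠ y in 𝓝 x, ‖k y‖ ≤ C}
  have hΩ : IsOpen Ω := by
    rw [isOpen_iff_mem_nhds]
    rintro x ⟨C, hC⟩
    filter_upwards [eventually_eventually_nhds.2 hC] with y hy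
    exact ⟨C, hy⟩
  obtain ⟨R, hR, hRX⟩ := nhds_basis_closedBall.mem_iff.1 (hXo.mem_nhds ha)
  obtain ⟨b, hba, hb⟩ := exists_mem_ball_eventually_bounded hXo hk ha (ε := R / 100) (by positivity)
  have hne : (Ωᶜ).Nonempty := ⟨a, hna⟩
  -- Let `a'` be a point nearest to `b` where local boundedness fails, at distance `r`. A bound on
  -- radius `7/8 * r` gives, with `s = 3/4 * r`, a bound on radius `9/8 * r`, which covers a
  -- neighbourhood of `a'`. The factor `R / 100` leaves room in `X` for the ball of radius `64 * s`.
  obtain ⟨a', ha', hr⟩ := hΩ.isClosed_compl.exists_infDist_eq_dist hne b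
  set r := infDist b Ωᶜ with hr_def
  have hr0 : 0 < r := (hΩ.isClosed_compl.notMem_iff_infDist_pos hne).1 (not_not.2 hb)
  have hrR : r < R / 100 := by
    refine (infDist_le_dist_of_mem (show a ∈ Ωᶜ from hna)).trans_lt ?_
    rw [dist_comm]
    rwa [mem_ball, dist_comm] at hba
  have hball : ball b r ⊆ Ω := by
    intro x hx
    by_contra hxn
    have := infDist_le_dist_of_mem (x := b) (show x ∈ Ωᶜ from hxn)
    rw [mem_ball, dist_comm] at hx
    linarith
  have hbX : ∀ q, q ≤ 64 * r → closedBall b q ⊆ X := by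
    intro q hq
    refine (closedBall_subset_closedBall' ?_).trans hRX
    rw [mem_ball] at hba
    linarith
  obtain ⟨C, hC⟩ : ∃ C, ∀ x ∈ closedBall b (7 / 8 * r), ‖k x‖ ≤ C := by
    refine (isCompact_closedBall b (7 / 8 * r)).induction_on
      (p := fun S => ∃ C, ∀ x ∈ S, ‖k x‖ ≤ C) ⟨0, by simp⟩ ?_ ?_ ?_
    · rintro S T hST ⟨C, hC⟩
      exact ⟨C, fun x hx => hC x (hST hx)⟩
    · rintro S T ⟨C, hC⟩ ⟨D, hD⟩
      refine ⟨max C D, fun x hx => hx.elim (fun h => (hC x h).trans (le_max_left _ _))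
        fun h => (hD x h).trans (le_max_right _ _)⟩
    · intro x hx
      obtain ⟨C, hC⟩ := hball (closedBall_subset_ball (by linarith) hx)
      exact ⟨_, mem_nhdsWithin_of_mem_nhds hC, C, fun y hy => hy⟩
  obtain ⟨C', hC'⟩ := exists_bound_of_bound_ball hdense hk (b := b) (s := 3 / 4 * r)
    (t := 7 / 8 * r) (by positivity) (by linarith)
    (ball_subset_closedBall.trans (hbX _ (by linarith))) (hbX _ (by linarith))
    fun x hx => hC x (ball_subset_closedBall hx)
  refine ha' ⟨C', ?_⟩
  have hmem : closedBall b (3 / 2 * (3 / 4 * r)) ∈ 𝓝 a' := by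
    refine mem_of_superset (isOpen_ball.mem_nhds (?_ : a' ∈ ball b (3 / 2 * (3 / 4 * r))))
      ball_subset_closedBall
    rw [mem_ball, dist_comm, ← hr]
    linarith
  filter_upwards [hmem] with y hy using hC' y hy

theorem differentiableOn_toDual {k : E → F} {X : Set E} (hXo : IsOpen X)
    (hdense : DenseRange (Finsupp.linearCombination ℂ (fun y : X => k y)))
    (hk : ∀ y ∈ X, DifferentiableOn ℂ (fun x => inner ℂ (k x) (k y)) X) :
    DifferentiableOn ℂ (fun x => toDual ℂ F (k x)) X := by
  intro a ha
  obtain ⟨C, hC⟩ := eventually_bounded_of_separately hXo hdense hk ha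
  obtain ⟨ρ, hρ, hsub⟩ := Metric.mem_nhds_iff.1 (inter_mem hC (hXo.mem_nhds ha))
  exact (differentiableAt_toDual hρ hdense
    (fun y hy => (hk y hy).mono (hsub.trans inter_subset_right))
    fun x hx => (hsub hx).1).differentiableWithinAt

end SeparateHolomorphy

/-! ### Identity theorem and polarization -/

section Identity

open Metric Set Filter Topology

variable {E : Type*} [NormedAddCommGroup E] [NormedSpace ℂ E]

theorem convex_preimage_line (b v : E) {S : Set E} (hS : Convex ℝ S) :
    Convex ℝ ((fun z : ℂ => b + z • v) ⁻¹' S) :=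
  (hS.translate_preimage_right b).is_linear_preimage
    (((ContinuousLinearMap.toSpanSingleton ℂ v).restrictScalars ℝ).toLinearMap.isLinear)

/-- The identity theorem for holomorphic functions on a connected open subset of a complex normed
space. -/
theorem eqOn_zero_of_eventuallyEq_zero {X : Set E} (hXo : IsOpen X) (hXc : IsPreconnected X)
    {f : E → ℂ} (hf : DifferentiableOn ℂ f X) {a : E} (ha : a ∈ X) (hfa : f =ᶠ[𝓝 a] 0) :
    ∀ x ∈ X, f x = 0 := by
  -- The points with vanishing germ form an open set; it is relatively closed in `X` because, in a
  -- ball, the complex line from a point of `S` to any other point reduces to the one-variable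
  -- identity theorem.
  let S : Set E := {x | f =ᶠ[𝓝 x] 0}
  have hS : IsOpen S := by
    rw [isOpen_iff_mem_nhds]
    intro x hx
    exact eventually_eventually_nhds.2 hx
  suffices X ⊆ S from fun x hx => (this hx).eq_of_nhds
  refine hXc.subset_of_closure_inter_subset hS ⟨a, ha, hfa⟩ ?_
  rintro p ⟨hp, hpX⟩
  obtain ⟨ε, hε, hεX⟩ := Metric.isOpen_iff.1 hXo p hpX
  obtain ⟨b, hb, hbS⟩ := mem_closure_iff_nhds.1 hp _ (ball_mem_nhds p hε)
  filter_upwards [ball_mem_nhds p hε] with c hc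
  let L : ℂ → E := fun z => b + z • (c - b)
  have hL : Continuous L := by fun_prop
  have hD : IsOpen (L ⁻¹' ball p ε) := isOpen_ball.preimage hL
  have hDc : Convex ℝ (L ⁻¹' ball p ε) := convex_preimage_line b (c - b) (convex_ball p ε)
  have hg : AnalyticOnNhd ℂ (fun z => f (L z)) (L ⁻¹' ball p ε) :=
    DifferentiableOn.analyticOnNhd ((hf.mono hεX).comp (by fun_prop) fun z hz => hz) hD
  have h0 : (fun z => f (L z)) =ᶠ[𝓝 0] 0 := by
    have hL0 : Tendsto L (𝓝 0) (𝓝 b) := by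
      have := hL.tendsto 0
      simpa [L] using this
    exact hL0.eventually hbS
  have := hg.eqOn_zero_of_preconnected_of_eventuallyEq_zero hDc.isPreconnected
    (z₀ := 0) (by simpa [L] using hb) h0
  have h1 := this (x := 1) (by simpa [L] using hc)
  simpa [L] using h1

theorem eq_of_eventuallyEq {X : Set E} (hXo : IsOpen X) (hXc : IsPreconnected X) {f g : E → ℂ}
    (hf : DifferentiableOn ℂ f X) (hg : DifferentiableOn ℂ g X) {a : E} (ha : a ∈ X)
    (hfg : f =ᶠ[𝓝 a] g) {x : E} (hx : x ∈ X) : f x = g x := by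
  refine sub_eq_zero.1 (eqOn_zero_of_eventuallyEq_zero hXo hXc (hf.sub hg) ha ?_ x hx)
  filter_upwards [hfg] with y hy
  simp [hy]

theorem eq_zero_of_forall_real {f : ℂ → ℂ} {ε : ℝ} (hf : DifferentiableOn ℂ f (ball 0 ε))
    (hr : ∀ x : ℝ, |x| < ε → f x = 0) : ∀ z ∈ ball (0 : ℂ) ε, f z = 0 := by
  intro z hz
  have hε : 0 < ε := pos_of_mem_ball hz
  refine (hf.analyticOnNhd isOpen_ball).eqOn_zero_of_preconnected_of_frequently_eq_zero
    (convex_ball 0 ε).isPreconnected (mem_ball_self hε) ?_ hz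
  have htend : Tendsto (fun x : ℝ => (x : ℂ)) (𝓝[≠] 0) (𝓝[≠] 0) := by
    refine tendsto_nhdsWithin_iff.2 ⟨?_, ?_⟩
    · exact (Complex.continuous_ofReal.tendsto' 0 0 (by simp)).mono_left nhdsWithin_le_nhds
    · filter_upwards [self_mem_nhdsWithin] with x hx
      simpa using hx
  refine htend.frequently (Eventually.frequently ?_)
  filter_upwards [mem_nhdsWithin_of_mem_nhds (ball_mem_nhds (0 : ℝ) hε)] with x hx
  exact hr x (by simpa using hx)

/-- The set of pairs `(s, τ)` with `s ∈ D` and `conj τ ∈ D`. -/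
def conjSquare (D : Set ℂ) : Set (ℂ × ℂ) := {p | p.1 ∈ D ∧ conj p.2 ∈ D}

/-- `g` is jointly holomorphic in the first and antiholomorphic in the second variable on `D`. -/
def JointlySesquiHolomorphicOn (g : ℂ → ℂ → ℂ) (D : Set ℂ) : Prop :=
  DifferentiableOn ℂ (fun p : ℂ × ℂ => g p.1 (conj p.2)) (conjSquare D)

namespace JointlySesquiHolomorphicOn

variable {g h : ℂ → ℂ → ℂ} {D : Set ℂ}

theorem sub (hg : JointlySesquiHolomorphicOn g D) (hh : JointlySesquiHolomorphicOn h D) :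
    JointlySesquiHolomorphicOn (fun s t => g s t - h s t) D :=
  DifferentiableOn.fun_sub hg hh

theorem mul (hg : JointlySesquiHolomorphicOn g D) (hh : JointlySesquiHolomorphicOn h D) :
    JointlySesquiHolomorphicOn (fun s t => g s t * h s t) D :=
  DifferentiableOn.fun_mul hg hh

theorem mul_const (hg : JointlySesquiHolomorphicOn g D) (c : ℂ) :
    JointlySesquiHolomorphicOn (fun s t => g s t * c) D :=
  DifferentiableOn.mul_const hg c

theorem pow (hg : JointlySesquiHolomorphicOn g D) (m : ℕ) :
    JointlySesquiHolomorphicOn (fun s t => g s t ^ m) D :=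
  DifferentiableOn.fun_pow hg m

theorem div (hg : JointlySesquiHolomorphicOn g D) (hh : JointlySesquiHolomorphicOn h D)
    (h0 : ∀ s ∈ D, ∀ t ∈ D, h s t ≠ 0) :
    JointlySesquiHolomorphicOn (fun s t => g s t / h s t) D := by
  have hg' : DifferentiableOn ℂ (fun p : ℂ × ℂ => g p.1 (conj p.2)) (conjSquare D) := hg
  have hh' : DifferentiableOn ℂ (fun p : ℂ × ℂ => h p.1 (conj p.2)) (conjSquare D) := hh
  have := hg'.fun_mul (hh'.fun_inv fun p hp => h0 _ hp.1 _ hp.2)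
  simpa only [JointlySesquiHolomorphicOn, div_eq_mul_inv] using this

/-- Polarization: a sesquiholomorphic function vanishing on the diagonal vanishes. -/
theorem eq_zero (hD : IsOpen D) (hDc : Convex ℝ D) (hg : JointlySesquiHolomorphicOn g D) (hdiag : ∀ s ∈ D, g s s = 0)
    {s t : ℂ} (hs : s ∈ D) (ht : t ∈ D) : g s t = 0 := by
  have hcc : Continuous fun p : ℂ × ℂ => conj p.2 := Complex.continuous_conj.comp continuous_snd
  have hQ : IsOpen (conjSquare D) := (hD.preimage continuous_fst).inter (hD.preimage hcc)
  have hQc : Convex ℝ (conjSquare D) := by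
    have h1 : Convex ℝ {p : ℂ × ℂ | p.1 ∈ D} := hDc.is_linear_preimage (LinearMap.fst ℝ ℂ ℂ).isLinear
    have h2 : Convex ℝ {p : ℂ × ℂ | conj p.2 ∈ D} :=
      hDc.is_linear_preimage
        ((Complex.conjCLE : ℂ →L[ℝ] ℂ).toLinearMap ∘ₗ LinearMap.snd ℝ ℂ ℂ).isLinear
    exact h1.inter h2
  -- In these coordinates the diagonal `p.2 = conj p.1` is the real plane, on which vanishing is
  -- known; it passes to complex arguments one variable at a time. `R` below is the inverse of `P`.
  let P : ℂ × ℂ → ℂ × ℂ := fun q => (s + (q.1 + Complex.I * q.2), conj s + (q.1 - Complex.I * q.2))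
  have hP : Differentiable ℂ P := by fun_prop
  have hsQ : (s, conj s) ∈ conjSquare D := ⟨hs, by simpa using hs⟩
  have hPnhds : P ⁻¹' conjSquare D ∈ 𝓝 (0 : ℂ × ℂ) :=
    hP.continuous.continuousAt.preimage_mem_nhds (hQ.mem_nhds (by simpa [P] using hsQ))
  obtain ⟨ε, hε, hεQ⟩ := Metric.mem_nhds_iff.1 hPnhds
  let h : ℂ × ℂ → ℂ := fun q => g (P q).1 (conj (P q).2)
  have hh : DifferentiableOn ℂ h (ball 0 ε) := hg.comp hP.differentiableOn hεQ
  have hmem : ∀ {z w : ℂ}, z ∈ ball (0 : ℂ) ε → w ∈ ball (0 : ℂ) ε →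
      (z, w) ∈ ball (0 : ℂ × ℂ) ε := by
    intro z w hz hw
    rw [mem_ball_zero_iff] at *
    exact max_lt hz hw
  have hreal : ∀ {x : ℝ}, |x| < ε → (x : ℂ) ∈ ball (0 : ℂ) ε := fun hx => by simpa using hx
  have hzw : ∀ z ∈ ball (0 : ℂ) ε, ∀ w ∈ ball (0 : ℂ) ε, h (z, w) = 0 := by
    intro z hz
    refine eq_zero_of_forall_real
      (hh.comp (by fun_prop) fun w hw => hmem hz hw) fun y hy => ?_
    refine eq_zero_of_forall_real (f := fun z => h (z, y))
      (hh.comp (by fun_prop) fun z hz => hmem hz (hreal hy)) (fun x hx => ?_) z hz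
    have hq := hεQ (hmem (hreal hx) (hreal hy))
    have : conj (P (x, y)).2 = (P (x, y)).1 := by
      simp [P]
    simp only [h, this]
    exact hdiag _ hq.1
  have hev : (fun p : ℂ × ℂ => g p.1 (conj p.2)) =ᶠ[𝓝 (s, conj s)] 0 := by
    let R : ℂ × ℂ → ℂ × ℂ := fun p =>
      (((p.1 - s) + (p.2 - conj s)) / 2, ((p.1 - s) - (p.2 - conj s)) / (2 * Complex.I))
    have hR : Continuous R := by fun_prop
    have hR0 : Tendsto R (𝓝 (s, conj s)) (𝓝 0) :=
      hR.tendsto' _ _ (by simp [R])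
    filter_upwards [hR0.eventually (ball_mem_nhds 0 hε)] with p hp
    have hPR : P (R p) = p := by
      ext <;> simp only [P, R] <;> field_simp <;> ring
    have hp' : ‖R p‖ < ε := by simpa using hp
    have h0 := hzw (R p).1 (by simpa using (norm_fst_le _).trans_lt hp')
      (R p).2 (by simpa using (norm_snd_le _).trans_lt hp')
    have h1 : h (R p) = 0 := h0
    simp only [h, hPR] at h1
    exact h1
  have := eqOn_zero_of_eventuallyEq_zero hQ hQc.isPreconnected hg hsQ hev (s, conj t)
    ⟨hs, by simpa using ht⟩
  simpa using this

end JointlySesquiHolomorphicOn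

end Identity

/-! ### The inner product of the dual space along holomorphic curves -/

section DualInner

open InnerProductSpace

variable {F : Type*} [NormedAddCommGroup F] [InnerProductSpace ℂ F] [CompleteSpace F]

theorem dualInner_eq_apply (f h : StrongDual ℂ F) :
    dualInner f h = f ((toDual ℂ F).symm h) := by
  rw [dualInner, toDual_symm_apply]

theorem conj_dualInner (f h : StrongDual ℂ F) : conj (dualInner f h) = dualInner h f :=
  inner_conj_symm _ _

theorem dualInner_self (f : StrongDual ℂ F) : dualInner f f = (‖f‖ : ℂ) ^ 2 := by
  rw [dualInner, inner_self_eq_norm_sq_to_K, LinearIsometryEquiv.norm_map]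
  rfl

theorem dualInner_toDual (v w : F) : dualInner (toDual ℂ F v) (toDual ℂ F w) = inner ℂ v w := by
  simp [dualInner]

theorem hasDerivAt_dualInner_left {k : ℂ → StrongDual ℂ F} {k' : StrongDual ℂ F} {s : ℂ}
    (hk : HasDerivAt k k' s) (h : StrongDual ℂ F) :
    HasDerivAt (fun s => dualInner (k s) h) (dualInner k' h) s := by
  simp only [dualInner_eq_apply]
  simpa using hk.clm_apply (hasDerivAt_const s ((toDual ℂ F).symm h))

theorem jointlySesquiHolomorphicOn_dualInner {D : Set ℂ} (hD : IsOpen D) {α β : ℂ → StrongDual ℂ F}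
    (hα : DifferentiableOn ℂ α D) (hβ : DifferentiableOn ℂ β D) :
    JointlySesquiHolomorphicOn (fun s t => dualInner (α s) (β t)) D := by
  rintro ⟨s, τ⟩ ⟨hs, hτ⟩
  simp only at hs hτ
  simp only [dualInner_eq_apply]
  have h1 : DifferentiableAt ℂ α s := hα.differentiableAt (hD.mem_nhds hs)
  have h2 : DifferentiableAt ℂ (fun τ => (toDual ℂ F).symm (β (conj τ))) τ := by
    have := (hβ.differentiableAt (hD.mem_nhds hτ)).comp_semilinear₁ (starRingEnd ℂ)
      ((toDual ℂ F).symm.toContinuousLinearEquiv.toContinuousLinearMap)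
    simpa [Function.comp_def] using this
  have h3 : DifferentiableAt ℂ (fun p : ℂ × ℂ => α p.1) (s, τ) :=
    DifferentiableAt.comp (s, τ) (f := Prod.fst) h1 differentiableAt_fst
  have h4 : DifferentiableAt ℂ (fun p : ℂ × ℂ => (toDual ℂ F).symm (β (conj p.2))) (s, τ) :=
    DifferentiableAt.comp (s, τ) (f := Prod.snd) h2 differentiableAt_snd
  exact (h3.clm_apply h4).differentiableWithinAt

end DualInner

/-! ### Rigidity: the Fubini–Study form determines the kernel up to rescaling -/

section Rigidity

open Metric Set Filter Topology InnerProductSpace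

variable {F : Type*} [NormedAddCommGroup F] [InnerProductSpace ℂ F] [CompleteSpace F]

theorem fubiniStudy_eq (g f h : StrongDual ℂ F) :
    fubiniStudy g f h = dualInner f h / dualInner g g -
      dualInner f g * dualInner g h / dualInner g g ^ 2 := by
  rw [fubiniStudy, dualInner_self g]
  ring

theorem dualInner_self_ne_zero {g : StrongDual ℂ F} (hg : g ≠ 0) : dualInner g g ≠ 0 := by
  rw [dualInner_self]
  simpa using hg

theorem continuous_dualInner :
    Continuous fun p : StrongDual ℂ F × StrongDual ℂ F => dualInner p.1 p.2 := by
  unfold dualInner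
  fun_prop

theorem eq_of_hasDerivAt_zero {D : Set ℂ} (hD : IsOpen D) (hDc : Convex ℝ D) {f : ℂ → ℂ}
    (hf : ∀ s ∈ D, HasDerivAt f 0 s) {s t : ℂ} (hs : s ∈ D) (ht : t ∈ D) : f s = f t :=
  hD.is_const_of_deriv_eq_zero hDc.isPreconnected
    (fun s hs => (hf s hs).differentiableAt.differentiableWithinAt) (fun s hs => (hf s hs).deriv)
    hs ht

/-- Two holomorphic curves inducing the same Fubini–Study form have the same normalized kernel. -/
theorem dualInner_mul_eq_of_fubiniStudy_eq {D : Set ℂ} (hD : IsOpen D) (hDc : Convex ℝ D)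
    (h0 : 0 ∈ D) {k l : ℂ → StrongDual ℂ F} (hk : DifferentiableOn ℂ k D)
    (hl : DifferentiableOn ℂ l D) (hkn : ∀ s ∈ D, ∀ t ∈ D, dualInner (k s) (k t) ≠ 0)
    (hln : ∀ s ∈ D, ∀ t ∈ D, dualInner (l s) (l t) ≠ 0)
    (hFS : ∀ s ∈ D, fubiniStudy (k s) (deriv k s) (deriv k s) =
      fubiniStudy (l s) (deriv l s) (deriv l s)) {s : ℂ} (hs : s ∈ D) :
    dualInner (l s) (l s) * dualInner (k s) (k 0) * dualInner (k 0) (k s) * dualInner (l 0) (l 0) =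
      dualInner (k s) (k s) * dualInner (l s) (l 0) * dualInner (l 0) (l s) *
        dualInner (k 0) (k 0) := by
  have hk' : ∀ s ∈ D, HasDerivAt k (deriv k s) s := fun s hs =>
    (hk.differentiableAt (hD.mem_nhds hs)).hasDerivAt
  have hl' : ∀ s ∈ D, HasDerivAt l (deriv l s) s := fun s hs =>
    (hl.differentiableAt (hD.mem_nhds hs)).hasDerivAt
  -- The polarized form of `hFS`: the mixed derivative of `log (⟨k s, k t⟩ / ⟨l s, l t⟩)`,
  -- holomorphic in `s` and antiholomorphic in `t`, vanishes off the diagonal too.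
  have hpol : ∀ s ∈ D, ∀ t ∈ D,
      dualInner (deriv k s) (deriv k t) / dualInner (k s) (k t) -
        dualInner (deriv k s) (k t) * dualInner (k s) (deriv k t) / dualInner (k s) (k t) ^ 2 -
      (dualInner (deriv l s) (deriv l t) / dualInner (l s) (l t) -
        dualInner (deriv l s) (l t) * dualInner (l s) (deriv l t) / dualInner (l s) (l t) ^ 2)
        = 0 := by
    have base := @jointlySesquiHolomorphicOn_dualInner F _ _ _ D hD
    intro s hs t ht
    refine JointlySesquiHolomorphicOn.eq_zero (g := fun s t =>
      dualInner (deriv k s) (deriv k t) / dualInner (k s) (k t) -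
        dualInner (deriv k s) (k t) * dualInner (k s) (deriv k t) / dualInner (k s) (k t) ^ 2 -
      (dualInner (deriv l s) (deriv l t) / dualInner (l s) (l t) -
        dualInner (deriv l s) (l t) * dualInner (l s) (deriv l t) / dualInner (l s) (l t) ^ 2))
      hD hDc ?_ (fun s hs => ?_) hs ht
    · have hform : ∀ {q : ℂ → StrongDual ℂ F}, DifferentiableOn ℂ q D →
          (∀ s ∈ D, ∀ t ∈ D, dualInner (q s) (q t) ≠ 0) →
          JointlySesquiHolomorphicOn (fun s t =>
            dualInner (deriv q s) (deriv q t) / dualInner (q s) (q t) -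
            dualInner (deriv q s) (q t) * dualInner (q s) (deriv q t) /
              dualInner (q s) (q t) ^ 2) D := by
        intro q hq hqn
        have hdq := hq.deriv hD
        exact ((base hdq hdq).div (base hq hq) hqn).sub (((base hdq hq).mul (base hq hdq)).div
          ((base hq hq).pow 2) fun s hs t ht => pow_ne_zero 2 (hqn s hs t ht))
      exact (hform hk hkn).sub (hform hl hln)
    · have := hFS s hs
      rw [fubiniStudy_eq, fubiniStudy_eq] at this
      exact sub_eq_zero.2 this
  -- First integration: the logarithmic derivative in `conj t` does not depend on `s`.
  have hone : ∀ s ∈ D, ∀ t ∈ D,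
      dualInner (k s) (deriv k t) / dualInner (k s) (k t) -
        dualInner (l s) (deriv l t) / dualInner (l s) (l t) =
      dualInner (k 0) (deriv k t) / dualInner (k 0) (k t) -
        dualInner (l 0) (deriv l t) / dualInner (l 0) (l t) := by
    intro s hs t ht
    refine eq_of_hasDerivAt_zero hD hDc (f := fun s =>
      dualInner (k s) (deriv k t) / dualInner (k s) (k t) -
        dualInner (l s) (deriv l t) / dualInner (l s) (l t)) (fun s hs => ?_) hs h0
    have h1 := (hasDerivAt_dualInner_left (hk' s hs) (deriv k t)).fun_div
      (hasDerivAt_dualInner_left (hk' s hs) (k t)) (hkn s hs t ht)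
    have h2 := (hasDerivAt_dualInner_left (hl' s hs) (deriv l t)).fun_div
      (hasDerivAt_dualInner_left (hl' s hs) (l t)) (hln s hs t ht)
    refine (h1.fun_sub h2).congr_deriv ?_
    rw [← hpol s hs t ht]
    have := hkn s hs t ht
    have := hln s hs t ht
    field_simp
  -- Second integration, after conjugating `hone`: the exponentiated form avoids branches of the
  -- logarithm. The claim is the comparison of `t = s` with `t = 0`.
  have htwo : ∀ t ∈ D,
      dualInner (k t) (k s) * dualInner (l t) (l 0) / (dualInner (l t) (l s) * dualInner (k t) (k 0))
        = dualInner (k 0) (k s) * dualInner (l 0) (l 0) /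
          (dualInner (l 0) (l s) * dualInner (k 0) (k 0)) := by
    intro t ht
    refine eq_of_hasDerivAt_zero hD hDc (f := fun t =>
      dualInner (k t) (k s) * dualInner (l t) (l 0) /
        (dualInner (l t) (l s) * dualInner (k t) (k 0))) (fun t ht => ?_) ht h0
    have h1 := ((hasDerivAt_dualInner_left (hk' t ht) (k s)).fun_mul
      (hasDerivAt_dualInner_left (hl' t ht) (l 0))).fun_div
      ((hasDerivAt_dualInner_left (hl' t ht) (l s)).fun_mul
      (hasDerivAt_dualInner_left (hk' t ht) (k 0)))
      (mul_ne_zero (hln t ht s hs) (hkn t ht 0 h0))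
    refine h1.congr_deriv ?_
    have hc := congrArg conj (hone s hs t ht)
    simp only [map_sub, map_div₀, conj_dualInner] at hc
    have n1 := hkn t ht s hs
    have n2 := hln t ht s hs
    have n3 := hkn t ht 0 h0
    have n4 := hln t ht 0 h0
    rw [div_eq_zero_iff]
    left
    field_simp at hc
    linear_combination hc
  have := htwo s hs
  rw [div_eq_div_iff (mul_ne_zero (hln s hs s hs) (hkn s hs 0 h0))
    (mul_ne_zero (hln 0 h0 s hs) (hkn 0 h0 0 h0))] at this
  linear_combination -this

variable {E : Type*} [NormedAddCommGroup E] [NormedSpace ℂ E]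

/-- Both kernels are nonzero on a small ball squared by continuity, so the one-variable statement
applies on the complex line joining `a` to `x`, at parameters `0` and `1`. -/
theorem eventually_dualInner_mul_eq {X : Set E} (hXo : IsOpen X) {κ l : E → StrongDual ℂ F}
    (hκ : DifferentiableOn ℂ κ X) (hl : DifferentiableOn ℂ l X) {a : E} (ha : a ∈ X)
    (hκa : κ a ≠ 0) (hla : l a ≠ 0)
    (hFS : ∀ x ∈ X, ∀ u, fubiniStudy (κ x) (fderiv ℂ κ x u) (fderiv ℂ κ x u) =
      fubiniStudy (l x) (fderiv ℂ l x u) (fderiv ℂ l x u)) :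
    ∀ᶠ x in 𝓝 a, dualInner (l x) (l x) * dualInner (κ x) (κ a) * dualInner (κ a) (κ x) *
        dualInner (l a) (l a) =
      dualInner (κ x) (κ x) * dualInner (l x) (l a) * dualInner (l a) (l x) *
        dualInner (κ a) (κ a) := by
  have hne : ∀ {q : E → StrongDual ℂ F}, DifferentiableOn ℂ q X → q a ≠ 0 →
      ∀ᶠ p : E × E in 𝓝 (a, a), dualInner (q p.1) (q p.2) ≠ 0 := by
    intro q hq hqa
    have hc : ContinuousAt q a := (hq.differentiableAt (hXo.mem_nhds ha)).continuousAt
    have h2 : ContinuousAt (fun p : E × E => dualInner (q p.1) (q p.2)) (a, a) := by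
      have h3 : ContinuousAt (fun p : E × E => (q p.1, q p.2)) (a, a) :=
        ContinuousAt.prodMk (ContinuousAt.comp (x := (a, a)) (g := q) hc continuousAt_fst)
          (ContinuousAt.comp (x := (a, a)) (g := q) hc continuousAt_snd)
      exact continuous_dualInner.continuousAt.comp h3
    exact h2.eventually_ne (dualInner_self_ne_zero hqa)
  have hX2 : ∀ᶠ p : E × E in 𝓝 (a, a), p.1 ∈ X :=
    continuousAt_fst.eventually (hXo.mem_nhds ha)
  obtain ⟨ε, hε, hsub⟩ := Metric.eventually_nhds_iff.1 ((hne hκ hκa).and ((hne hl hla).and hX2))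
  have hpair : ∀ x ∈ ball a ε, ∀ y ∈ ball a ε, dist (x, y) (a, a) < ε := fun x hx y hy =>
    max_lt hx hy
  filter_upwards [ball_mem_nhds a hε] with x hx
  let L : ℂ → E := fun z => a + z • (x - a)
  have hLd : ∀ z, HasDerivAt L (x - a) z := fun z => by
    simpa [L] using ((hasDerivAt_id z).smul_const (x - a)).const_add a
  let D : Set ℂ := L ⁻¹' ball a ε
  have hD : IsOpen D := isOpen_ball.preimage (by fun_prop)
  have hDX : ∀ z ∈ D, L z ∈ X := fun z hz => (hsub (hpair _ hz _ hz)).2.2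
  have hder : ∀ {q : E → StrongDual ℂ F}, DifferentiableOn ℂ q X → ∀ z ∈ D,
      HasDerivAt (fun z => q (L z)) (fderiv ℂ q (L z) (x - a)) z := fun hq z hz =>
    ((hq.differentiableAt (hXo.mem_nhds (hDX z hz))).hasFDerivAt).comp_hasDerivAt z (hLd z)
  have key := dualInner_mul_eq_of_fubiniStudy_eq (D := D) (k := fun z => κ (L z))
    (l := fun z => l (L z)) hD (convex_preimage_line a (x - a) (convex_ball a ε))
    (by simpa [D, L] using hε)
    (fun z hz => (hder hκ z hz).differentiableAt.differentiableWithinAt)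
    (fun z hz => (hder hl z hz).differentiableAt.differentiableWithinAt)
    (fun s hs t ht => (hsub (hpair _ hs _ ht)).1) (fun s hs t ht => (hsub (hpair _ hs _ ht)).2.1)
    (fun s hs => by
      rw [(hder hκ s hs).deriv, (hder hl s hs).deriv]
      exact hFS _ (hDX s hs) _) (s := 1) (by simpa [D, L] using hx)
  simpa [L] using key

theorem differentiableOn_dualInner_left {X : Set E} {κ : E → StrongDual ℂ F}
    (hκ : DifferentiableOn ℂ κ X) (h : StrongDual ℂ F) :
    DifferentiableOn ℂ (fun x => dualInner (κ x) h) X := by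
  simp only [dualInner_eq_apply]
  exact hκ.clm_apply (by fun_prop)

/-- The identity between normalized kernels near one point propagates, in polarized form, to the
whole domain. -/
theorem dualInner_mul_eq_of_diagonal {X U : Set E} (hXo : IsOpen X) (hXc : IsPreconnected X)
    {κ l : E → StrongDual ℂ F} (hκ : DifferentiableOn ℂ κ X) (hl : DifferentiableOn ℂ l X)
    (hUo : IsOpen U) (hU : U.Nonempty) (hUX : U ⊆ X) (p q : StrongDual ℂ F) (c d : ℂ)
    (hdiag : ∀ x ∈ U, dualInner (l x) (l x) * dualInner (κ x) p * dualInner p (κ x) * c =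
      dualInner (κ x) (κ x) * dualInner (l x) q * dualInner q (l x) * d)
    {x y : E} (hx : x ∈ X) (hy : y ∈ X) :
    dualInner (l x) (l y) * dualInner (κ x) p * dualInner p (κ y) * c =
      dualInner (κ x) (κ y) * dualInner (l x) q * dualInner q (l y) * d := by
  obtain ⟨a, haU⟩ := hU
  obtain ⟨ε, hε, hεU⟩ := Metric.isOpen_iff.1 hUo a haU
  -- Polarization on the complex line through `x` and `y`, evaluated at parameters `0` and `1`. The
  -- identity theorem then frees `x` and, after conjugation, `y`.
  have hloc : ∀ x ∈ ball a ε, ∀ y ∈ ball a ε,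
      dualInner (l x) (l y) * dualInner (κ x) p * dualInner p (κ y) * c =
        dualInner (κ x) (κ y) * dualInner (l x) q * dualInner q (l y) * d := by
    intro x hx y hy
    let L : ℂ → E := fun z => x + z • (y - x)
    let D : Set ℂ := L ⁻¹' ball a ε
    have hD : IsOpen D := isOpen_ball.preimage (by fun_prop)
    have hcomp : ∀ {r : E → StrongDual ℂ F}, DifferentiableOn ℂ r X →
        DifferentiableOn ℂ (fun z => r (L z)) D := fun hr =>
      hr.comp (by fun_prop) fun z hz => hUX (hεU hz)
    have base := @jointlySesquiHolomorphicOn_dualInner F _ _ _ D hD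
    have hcst : ∀ r : StrongDual ℂ F, DifferentiableOn ℂ (fun _ : ℂ => r) D := fun r =>
      differentiableOn_const r
    have key := JointlySesquiHolomorphicOn.eq_zero (D := D) (g := fun s t =>
      dualInner (l (L s)) (l (L t)) * dualInner (κ (L s)) p * dualInner p (κ (L t)) * c -
        dualInner (κ (L s)) (κ (L t)) * dualInner (l (L s)) q * dualInner q (l (L t)) * d)
      hD (convex_preimage_line x (y - x) (convex_ball a ε))
      (((((base (hcomp hl) (hcomp hl)).mul (base (hcomp hκ) (hcst p))).mul
          (base (hcst p) (hcomp hκ))).mul_const c).sub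
        ((((base (hcomp hκ) (hcomp hκ)).mul (base (hcomp hl) (hcst q))).mul
          (base (hcst q) (hcomp hl))).mul_const d))
      (fun s hs => sub_eq_zero.2 (hdiag _ (hεU hs)))
      (s := 0) (t := 1) (by simpa [D, L] using hx) (by simpa [D, L] using hy)
    simpa [L, sub_eq_zero] using key
  have haX := hUX haU
  have hhalf : ∀ x ∈ X, ∀ y ∈ ball a ε,
      dualInner (l x) (l y) * dualInner (κ x) p * dualInner p (κ y) * c =
        dualInner (κ x) (κ y) * dualInner (l x) q * dualInner q (l y) * d := by
    intro x hx y hy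
    refine eq_of_eventuallyEq hXo hXc
      (f := fun x => dualInner (l x) (l y) * dualInner (κ x) p * dualInner p (κ y) * c)
      (g := fun x => dualInner (κ x) (κ y) * dualInner (l x) q * dualInner q (l y) * d)
      ?_ ?_ haX ?_ hx
    · exact (((differentiableOn_dualInner_left hl _).mul
        (differentiableOn_dualInner_left hκ _)).mul_const _).mul_const _
    · exact (((differentiableOn_dualInner_left hκ _).mul
        (differentiableOn_dualInner_left hl _)).mul_const _).mul_const _
    · filter_upwards [ball_mem_nhds a hε] with z hz using hloc z hz y hy
  have hconj : ∀ y, conj (dualInner (l x) (l y) * dualInner (κ x) p * dualInner p (κ y) * c) =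
      dualInner (l y) (l x) * dualInner p (κ x) * dualInner (κ y) p * conj c := fun y => by
    simp only [map_mul, conj_dualInner]
  have hconj' : ∀ y, conj (dualInner (κ x) (κ y) * dualInner (l x) q * dualInner q (l y) * d) =
      dualInner (κ y) (κ x) * dualInner q (l x) * dualInner (l y) q * conj d := fun y => by
    simp only [map_mul, conj_dualInner]
  refine (starRingEnd ℂ).injective ?_
  rw [hconj, hconj']
  refine eq_of_eventuallyEq hXo hXc
    (f := fun y => dualInner (l y) (l x) * dualInner p (κ x) * dualInner (κ y) p * conj c)
    (g := fun y => dualInner (κ y) (κ x) * dualInner q (l x) * dualInner (l y) q * conj d)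
    ?_ ?_ haX ?_ hy
  · exact (((differentiableOn_dualInner_left hl _).mul_const _).mul
      (differentiableOn_dualInner_left hκ _)).mul_const _
  · exact (((differentiableOn_dualInner_left hκ _).mul_const _).mul
      (differentiableOn_dualInner_left hl _)).mul_const _
  · filter_upwards [ball_mem_nhds a hε] with z hz
    rw [← hconj, ← hconj', hhalf x hx z hz]

/-- Where `⟨κ x, κ a⟩ ≠ 0`, the polarized identity can be solved for the ratio of kernels, giving
`ω₀`. Elsewhere `a` is replaced by a point `p x` with `⟨κ x, κ (p x)⟩ ≠ 0`; cross-multiplied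
identities, which hold near `a` and hence on `X`, make the choice irrelevant. -/
theorem exists_rescaling_of_diagonal {X U : Set E} (hXo : IsOpen X) (hXc : IsPreconnected X)
    {κ l : E → StrongDual ℂ F} (hκ : DifferentiableOn ℂ κ X) (hl : DifferentiableOn ℂ l X)
    (hκ0 : ∀ x ∈ X, κ x ≠ 0) (hl0 : ∀ x ∈ X, l x ≠ 0)
    (hUo : IsOpen U) (hU : U.Nonempty) (hUX : U ⊆ X) {a : E} (ha : a ∈ X)
    (hdiag : ∀ x ∈ U, dualInner (l x) (l x) * dualInner (κ x) (κ a) * dualInner (κ a) (κ x) *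
        dualInner (l a) (l a) =
      dualInner (κ x) (κ x) * dualInner (l x) (l a) * dualInner (l a) (l x) *
        dualInner (κ a) (κ a)) :
    ∃ ω : E → ℂ, ∀ x ∈ X, ∀ y ∈ X,
      dualInner (l x) (l y) = ω x * conj (ω y) * dualInner (κ x) (κ y) := by
  have hpol : ∀ x ∈ X, ∀ y ∈ X, _ := fun x hx y hy => dualInner_mul_eq_of_diagonal hXo hXc hκ hl
    hUo hU hUX (κ a) (l a) (dualInner (l a) (l a)) (dualInner (κ a) (κ a)) hdiag hx hy
  let G : Set E := {x ∈ X | dualInner (κ x) (κ a) ≠ 0}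
  have haG : a ∈ G := ⟨ha, dualInner_self_ne_zero (hκ0 a ha)⟩
  have hGn : ∀ᶠ x in 𝓝 a, x ∈ G := by
    have hc : ContinuousAt (fun x => dualInner (κ x) (κ a)) a :=
      ((differentiableOn_dualInner_left hκ (κ a)).differentiableAt (hXo.mem_nhds ha)).continuousAt
    filter_upwards [hXo.mem_nhds ha, hc.eventually_ne haG.2] with x h1 h2 using ⟨h1, h2⟩
  -- The real constant that splits the factor `‖κ a‖ ^ 2 / ‖l a‖ ^ 2` symmetrically between `ω₀ x`
  -- and `conj (ω₀ y)`.
  let r : ℂ := ((‖κ a‖ / ‖l a‖ : ℝ) : ℂ)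
  have hrr : r * r * dualInner (l a) (l a) = dualInner (κ a) (κ a) := by
    have : (‖l a‖ : ℂ) ≠ 0 := by simpa using hl0 a ha
    rw [dualInner_self, dualInner_self]
    simp only [r, Complex.ofReal_div]
    field_simp
  have hrc : conj r = r := Complex.conj_ofReal _
  let ω₀ : E → ℂ := fun x => r * dualInner (l x) (l a) / dualInner (κ x) (κ a)
  have hG : ∀ x ∈ G, ∀ y ∈ G, dualInner (l x) (l y) = ω₀ x * conj (ω₀ y) * dualInner (κ x) (κ y) := by
    intro x hx y hy
    have h1 := hpol x hx.1 y hy.1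
    have hy2 : dualInner (κ a) (κ y) ≠ 0 := by
      rw [← conj_dualInner]
      exact (map_ne_zero _).2 hy.2
    have hx2 := hx.2
    have hl2 := dualInner_self_ne_zero (hl0 a ha)
    simp only [ω₀, map_div₀, map_mul, conj_dualInner, hrc]
    field_simp
    refine mul_right_cancel₀ hl2 ?_
    rw [← hrr] at h1
    linear_combination h1
  have hω₀ : ∀ x ∈ G, ω₀ x ≠ 0 := by
    intro x hx h0
    have := hG x hx x hx
    rw [h0, zero_mul, zero_mul] at this
    exact dualInner_self_ne_zero (hl0 x hx.1) this
  -- Otherwise `⟨κ y, κ x⟩` vanishes for `y` near `a`, hence on `X`, contradicting `⟨κ x, κ x⟩ ≠ 0`.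
  have hsel : ∀ x ∈ X, ∃ p ∈ G, dualInner (κ x) (κ p) ≠ 0 := by
    intro x hx
    by_contra! hall
    refine dualInner_self_ne_zero (hκ0 x hx) ?_
    refine eq_of_eventuallyEq hXo hXc (differentiableOn_dualInner_left hκ (κ x))
      (differentiableOn_const (0 : ℂ)) ha ?_ hx
    filter_upwards [hGn] with y hy
    rw [← conj_dualInner, hall y hy, map_zero]
  choose! p hpG hp using hsel
  let ω : E → ℂ := fun x => dualInner (l x) (l (p x)) / (conj (ω₀ (p x)) * dualInner (κ x) (κ (p x)))
  have hcω : ∀ z ∈ G, conj (ω₀ z) ≠ 0 := fun z hz => (map_ne_zero _).2 (hω₀ z hz)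
  have hmix : ∀ x ∈ X, ∀ z ∈ G,
      dualInner (l x) (l z) = ω x * conj (ω₀ z) * dualInner (κ x) (κ z) := by
    intro x hx z hz
    have hid : ∀ w ∈ G, ∀ x ∈ X, dualInner (l x) (l z) * (conj (ω₀ w) * dualInner (κ x) (κ w)) =
        dualInner (l x) (l w) * (conj (ω₀ z) * dualInner (κ x) (κ z)) := by
      intro w hw x hx
      refine eq_of_eventuallyEq hXo hXc
        (f := fun x => dualInner (l x) (l z) * (conj (ω₀ w) * dualInner (κ x) (κ w)))
        (g := fun x => dualInner (l x) (l w) * (conj (ω₀ z) * dualInner (κ x) (κ z)))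
        ?_ ?_ ha ?_ hx
      · exact (differentiableOn_dualInner_left hl _).mul
          ((differentiableOn_dualInner_left hκ _).const_mul _)
      · exact (differentiableOn_dualInner_left hl _).mul
          ((differentiableOn_dualInner_left hκ _).const_mul _)
      · filter_upwards [hGn] with y hy
        rw [hG y hy z hz, hG y hy w hw]
        ring
    have h1 := hid (p x) (hpG x hx) x hx
    have h2 := mul_ne_zero (hcω _ (hpG x hx)) (hp x hx)
    simp only [ω]
    rw [mul_assoc, div_mul_eq_mul_div, eq_div_iff h2]
    exact h1
  refine ⟨ω, fun x hx w hw => ?_⟩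
  have hpw := hpG w hw
  have hid : dualInner (l w) (l x) * (dualInner (κ w) (κ (p w)) * conj (ω₀ (p w))) =
      conj (ω x) * dualInner (κ w) (κ x) * dualInner (l w) (l (p w)) := by
    refine eq_of_eventuallyEq hXo hXc
      (f := fun w' => dualInner (l w') (l x) * (dualInner (κ w') (κ (p w)) * conj (ω₀ (p w))))
      (g := fun w' => conj (ω x) * dualInner (κ w') (κ x) * dualInner (l w') (l (p w)))
      ?_ ?_ ha ?_ hw
    · exact (differentiableOn_dualInner_left hl _).mul
        ((differentiableOn_dualInner_left hκ _).mul_const _)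
    · exact ((differentiableOn_dualInner_left hκ _).const_mul _).mul
        (differentiableOn_dualInner_left hl _)
    · filter_upwards [hGn] with z hz
      have h1 := congrArg conj (hmix x hx z hz)
      simp only [map_mul, conj_dualInner, Complex.conj_conj] at h1
      rw [h1, hG z hz _ hpw]
      ring
  have h2 : dualInner (κ w) (κ (p w)) * conj (ω₀ (p w)) ≠ 0 := mul_ne_zero (hp w hw) (hcω _ hpw)
  have h3 : dualInner (l w) (l x) = conj (ω x) * ω w * dualInner (κ w) (κ x) := by
    refine mul_right_cancel₀ h2 ?_
    rw [hid]
    simp only [ω]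
    have h4 := hp w hw
    have h5 := hcω _ hpw
    field_simp
  have h6 := congrArg conj h3
  simp only [map_mul, conj_dualInner, Complex.conj_conj] at h6
  exact h6

end Rigidity

/-! ### Invariance of the Fubini–Study form under scalars and unitaries -/

section DualInnerAlgebra

open InnerProductSpace

variable {F : Type*} [NormedAddCommGroup F] [InnerProductSpace ℂ F] [CompleteSpace F]

theorem dualInner_add_left (f g h : StrongDual ℂ F) :
    dualInner (f + g) h = dualInner f h + dualInner g h := by
  simp only [dualInner_eq_apply, add_apply]

theorem dualInner_smul_left (c : ℂ) (f h : StrongDual ℂ F) :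
    dualInner (c • f) h = c * dualInner f h := by
  simp only [dualInner_eq_apply]
  rfl

theorem dualInner_add_right (f g h : StrongDual ℂ F) :
    dualInner f (g + h) = dualInner f g + dualInner f h := by
  rw [← conj_dualInner, dualInner_add_left, map_add, conj_dualInner, conj_dualInner]

theorem dualInner_smul_right (c : ℂ) (f h : StrongDual ℂ F) :
    dualInner f (c • h) = conj c * dualInner f h := by
  rw [← conj_dualInner, dualInner_smul_left, map_mul, conj_dualInner]

/-- The Fubini–Study form does not see a rescaling of the curve. -/
theorem fubiniStudy_smul_add {c : ℂ} (hc : c ≠ 0) {g : StrongDual ℂ F} (hg : g ≠ 0) (α β : ℂ)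
    (f h : StrongDual ℂ F) :
    fubiniStudy (c • g) (c • f + α • g) (c • h + β • g) = fubiniStudy g f h := by
  have hgg := dualInner_self_ne_zero hg
  have hcc : conj c ≠ 0 := (map_ne_zero _).2 hc
  simp only [fubiniStudy_eq, dualInner_add_left, dualInner_add_right, dualInner_smul_left,
    dualInner_smul_right]
  field_simp
  ring

theorem dualInner_comp_unitary {W : F →L[ℂ] F} (hW : W ∈ unitary (F →L[ℂ] F))
    (f h : StrongDual ℂ F) : dualInner (f.comp W) (h.comp W) = dualInner f h := by
  have hsymm : ∀ f : StrongDual ℂ F, (toDual ℂ F).symm (f.comp W) =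
      ContinuousLinearMap.adjoint W ((toDual ℂ F).symm f) := by
    intro f
    refine ext_inner_right ℂ fun v => ?_
    rw [toDual_symm_apply, ContinuousLinearMap.adjoint_inner_left, toDual_symm_apply]
    rfl
  rw [dualInner, dualInner, hsymm, hsymm, ContinuousLinearMap.adjoint_inner_left]
  have : W * star W = 1 := (Unitary.mem_iff.1 hW).2
  have h2 := congrArg (fun T : F →L[ℂ] F => T ((toDual ℂ F).symm h)) this
  simp only [ContinuousLinearMap.star_eq_adjoint] at h2
  change W (ContinuousLinearMap.adjoint W ((toDual ℂ F).symm h)) = (toDual ℂ F).symm h at h2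
  rw [h2]

/-- Curves that agree up to a unitary and a scalar function have the same Fubini–Study form. -/
theorem fubiniStudy_fderiv_eq_of_smul {E : Type*} [NormedAddCommGroup E] [NormedSpace ℂ E]
    {κ l : E → StrongDual ℂ F} {W : F →L[ℂ] F} (hW : W ∈ unitary (F →L[ℂ] F)) {a : E}
    (hκ : DifferentiableAt ℂ κ a) (hl : DifferentiableAt ℂ l a) (hκa : κ a ≠ 0) (hla : l a ≠ 0)
    {ω : E → ℂ} (hω : ∀ᶠ x in nhds a, (κ x).comp W = ω x • l x) (u v : E) :
    fubiniStudy (l a) (fderiv ℂ l a u) (fderiv ℂ l a v) =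
      fubiniStudy (κ a) (fderiv ℂ κ a u) (fderiv ℂ κ a v) := by
  let C : StrongDual ℂ F →L[ℂ] StrongDual ℂ F := (ContinuousLinearMap.compL ℂ F F ℂ).flip W
  have hC : ∀ f, C f = f.comp W := fun f => rfl
  let μ : E → StrongDual ℂ F := fun x => C (κ x)
  have hμ : HasFDerivAt μ (C.comp (fderiv ℂ κ a)) a := C.hasFDerivAt.comp a hκ.hasFDerivAt
  have hla' := dualInner_self_ne_zero hla
  have hd : ∀ {q : E → StrongDual ℂ F}, DifferentiableAt ℂ q a →
      DifferentiableAt ℂ (fun x => dualInner (q x) (l a)) a := by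
    intro q hq
    simp only [dualInner_eq_apply]
    exact hq.clm_apply (differentiableAt_const _)
  -- No regularity of `ω` is assumed: near `a` it is the quotient of two pairings with `l a`.
  have hωd : DifferentiableAt ℂ ω a := by
    have h1 : DifferentiableAt ℂ
        (fun x => dualInner (μ x) (l a) * (dualInner (l x) (l a))⁻¹) a :=
      (hd hμ.differentiableAt).fun_mul ((hd hl).fun_inv hla')
    refine h1.congr_of_eventuallyEq ?_
    filter_upwards [hω, (hd hl).continuousAt.eventually_ne hla'] with x hx hx0
    simp only [μ, hC, hx, dualInner_smul_left]
    field_simp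
  have hω0 : ω a ≠ 0 := by
    intro h0
    refine dualInner_self_ne_zero hκa ?_
    rw [← dualInner_comp_unitary hW, hω.self_of_nhds, dualInner_smul_left, h0, zero_mul]
  have hμ' : HasFDerivAt μ (ω a • fderiv ℂ l a + (fderiv ℂ ω a).smulRight (l a)) a := by
    refine (hωd.hasFDerivAt.fun_smul hl.hasFDerivAt).congr_of_eventuallyEq ?_
    filter_upwards [hω] with x hx
    exact hx
  -- Differentiating `ω • l` adds only a radial term along `l a`, which the form annihilates.
  have hD : ∀ w, C (fderiv ℂ κ a w) = ω a • fderiv ℂ l a w + fderiv ℂ ω a w • l a := by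
    intro w
    have := congrArg (fun T : E →L[ℂ] StrongDual ℂ F => T w) (hμ.unique hμ')
    exact this
  have hinv : fubiniStudy (C (κ a)) (C (fderiv ℂ κ a u)) (C (fderiv ℂ κ a v)) =
      fubiniStudy (κ a) (fderiv ℂ κ a u) (fderiv ℂ κ a v) := by
    simp only [fubiniStudy_eq, hC, dualInner_comp_unitary hW]
  have hCa : C (κ a) = ω a • l a := hω.self_of_nhds
  rw [← hinv, hD, hD, hCa, fubiniStudy_smul_add hω0 hla]

end DualInnerAlgebra

/-! ### Reproducing kernels and the unitary attached to a rescaling -/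

section Kernel

open InnerProductSpace Submodule

variable {X : Type*} {F : Type*} [NormedAddCommGroup F] [InnerProductSpace ℂ F] [CompleteSpace F]
  [RKHS ℂ F X ℂ]

theorem inner_kerFun_one (x : X) (f : F) : inner ℂ (RKHS.kerFun F x (1 : ℂ)) f = f x := by
  simp

theorem HasKernel.inner_kerFun {K : X → X → ℂ} (hF : HasKernel F K) (x y : X) :
    inner ℂ (RKHS.kerFun F x (1 : ℂ)) (RKHS.kerFun F y (1 : ℂ)) = K x y := by
  rw [inner_kerFun_one, hF]

theorem HasKernel.dualInner_evalMap {K : X → X → ℂ} (hF : HasKernel F K) (x y : X) :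
    dualInner (evalMap F x) (evalMap F y) = K x y := by
  rw [evalMap, evalMap, dualInner_toDual, hF.inner_kerFun]

theorem HasKernel.conj_apply {K : X → X → ℂ} (hF : HasKernel F K) (x y : X) :
    conj (K x y) = K y x := by
  rw [← hF.dualInner_evalMap, conj_dualInner, hF.dualInner_evalMap]

theorem HasKernel.norm_evalMap_sq {K : X → X → ℂ} (hF : HasKernel F K) (x : X) :
    (‖evalMap F x‖ : ℂ) ^ 2 = K x x := by
  rw [← dualInner_self, hF.dualInner_evalMap]

theorem HasKernel.evalMap_ne_zero {K : X → X → ℂ} (hF : HasKernel F K) (hK : IsNondegenerate K)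
    (x : X) : evalMap F x ≠ 0 := by
  intro h
  have := hF.norm_evalMap_sq x
  rw [h, norm_zero] at this
  have h0 := hK x
  rw [← this] at h0
  simp at h0

theorem denseRange_linearCombination_of_kerFun_mem {ι : Type*} {e : ι → F}
    (he : ∀ x, RKHS.kerFun F x (1 : ℂ) ∈ span ℂ (Set.range e)) :
    DenseRange (Finsupp.linearCombination ℂ e) := by
  have hle : span ℂ {RKHS.kerFun F x v | (x : X) (v : ℂ)} ≤ span ℂ (Set.range e) := by
    rw [span_le]
    rintro _ ⟨x, v, rfl⟩
    have : RKHS.kerFun F x v = v • RKHS.kerFun F x (1 : ℂ) := by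
      rw [← map_smul, smul_eq_mul, mul_one]
    rw [SetLike.mem_coe, this]
    exact smul_mem _ _ (he x)
  have htop : (span ℂ (Set.range e)).topologicalClosure = ⊤ := by
    rw [eq_top_iff, ← RKHS.kerFun_dense F]
    exact topologicalClosure_mono hle
  have hd := dense_iff_topologicalClosure_eq_top.2 htop
  rw [← Finsupp.range_linearCombination] at hd
  exact hd

/-- If the pull-back of the kernel by a bijection is a rescaling of the kernel, then a weighted
composition operator with this bijection is unitary. -/
theorem HasKernel.exists_unitary_of_isRescaling {K : X → X → ℂ} (hF : HasKernel F K)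
    {Φ : X ≃ X} {ω : X → ℂ} (hω0 : ∀ x, ω x ≠ 0)
    (hω : ∀ x y, K (Φ x) (Φ y) = ω x * conj (ω y) * K x y) :
    ∃ (ω' : X → ℂ) (W : F →L[ℂ] F), IsWeightedComposition F W ω' Φ ∧ W ∈ unitary (F →L[ℂ] F) := by
  have hc0 : ∀ x, conj (ω x) ≠ 0 := fun x => (map_ne_zero _).2 (hω0 x)
  let v₁ : X → F := fun x => RKHS.kerFun F x (1 : ℂ)
  let v₂ : X → F := fun x => (conj (ω x))⁻¹ • RKHS.kerFun F (Φ x) (1 : ℂ)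
  have hgram : ∀ x y, inner ℂ (v₂ x) (v₂ y) = inner ℂ (v₁ x) (v₁ y) := by
    intro x y
    simp only [v₁, v₂]
    rw [inner_smul_left, inner_smul_right, hF.inner_kerFun, hF.inner_kerFun, hω, map_inv₀,
      Complex.conj_conj]
    have := hω0 x
    have := hc0 y
    field_simp
  have hnorm : ∀ c : X →₀ ℂ, ‖Finsupp.linearCombination ℂ v₂ c‖ =
      ‖Finsupp.linearCombination ℂ v₁ c‖ := by
    intro c
    have : (inner ℂ (Finsupp.linearCombination ℂ v₂ c) (Finsupp.linearCombination ℂ v₂ c) : ℂ) =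
        inner ℂ (Finsupp.linearCombination ℂ v₁ c) (Finsupp.linearCombination ℂ v₁ c) := by
      simp only [Finsupp.linearCombination_apply, Finsupp.sum, inner_sum, sum_inner,
        inner_smul_left, inner_smul_right, hgram]
    rw [@norm_eq_sqrt_re_inner ℂ, @norm_eq_sqrt_re_inner ℂ, this]
  have hd₁ : DenseRange (Finsupp.linearCombination ℂ v₁) :=
    denseRange_linearCombination_of_kerFun_mem fun x => subset_span ⟨x, rfl⟩
  have hd₂ : DenseRange (Finsupp.linearCombination ℂ v₂) := by
    refine denseRange_linearCombination_of_kerFun_mem fun x => ?_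
    have : RKHS.kerFun F x (1 : ℂ) = conj (ω (Φ.symm x)) • v₂ (Φ.symm x) := by
      simp only [v₂]
      rw [smul_inv_smul₀ (hc0 _), Equiv.apply_symm_apply]
    rw [this]
    exact smul_mem _ _ (subset_span ⟨_, rfl⟩)
  -- Equal Gram matrices and totality of both families (for `v₂`, by surjectivity of `Φ`) give a
  -- unitary. The composition operator is `T⁻¹`: pairing `T.symm f` with `v₁ x` is pairing `f` with
  -- `v₂ x`, whence the weight `(ω x)⁻¹`.
  let T : F ≃ₗᵢ[ℂ] F := (LinearEquiv.refl ℂ (X →₀ ℂ)).extendOfIsometry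
    (Finsupp.linearCombination ℂ v₁) (Finsupp.linearCombination ℂ v₂) hd₁ hd₂ hnorm
  have hT : ∀ x, T (v₁ x) = v₂ x := by
    intro x
    have h := LinearMap.extendOfNorm_eq (f := Finsupp.linearCombination ℂ v₂) hd₁
      ⟨1, fun c => by rw [one_mul, hnorm]⟩ (Finsupp.single x 1)
    simp only [Finsupp.linearCombination_single, one_smul] at h
    exact h
  let U := Unitary.linearIsometryEquiv.symm T.symm
  refine ⟨fun x => (ω x)⁻¹, U, fun f x => ?_, U.2⟩
  have hU : (U : F →L[ℂ] F) f = T.symm f := rfl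
  rw [hU, ← inner_kerFun_one x, ← inner_kerFun_one (Φ x), ← T.inner_map_map,
    LinearIsometryEquiv.apply_symm_apply]
  change inner ℂ (T (v₁ x)) f = _
  rw [hT]
  simp only [v₂]
  rw [inner_smul_left, map_inv₀, Complex.conj_conj]

end Kernel

/-! ### The normalized kernel and the two distances -/

section Normalized

variable {X : Type*} {F : Type*} [NormedAddCommGroup F] [InnerProductSpace ℂ F] [CompleteSpace F]
  [RKHS ℂ F X ℂ] {K : X → X → ℂ}

theorem HasKernel.normalizedSq_eq_div (hF : HasKernel F K) (x y : X) :
    normalizedSq K x y = K x y * K y x / (K x x * K y y) := by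
  rw [normalizedSq, ← hF.conj_apply x y, Complex.mul_conj, Complex.normSq_eq_norm_sq]

theorem HasKernel.normalizedSq_eq_iff (hF : HasKernel F K) (hK : IsNondegenerate K)
    (x y x' y' : X) : normalizedSq K x' y' = normalizedSq K x y ↔
      K x' x' * K x y * K y x * K y' y' = K x x * K x' y' * K y' x' * K y y := by
  have hK' : ∀ x, K x x ≠ 0 := fun x => (hK x).ne'
  rw [hF.normalizedSq_eq_div, hF.normalizedSq_eq_div, div_eq_div_iff (mul_ne_zero (hK' _) (hK' _))
    (mul_ne_zero (hK' _) (hK' _))]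
  constructor <;> intro h <;> linear_combination -h

theorem norm_dualInner_div_le_one (g h : StrongDual ℂ F) :
    ‖dualInner g h‖ / (‖g‖ * ‖h‖) ≤ 1 := by
  refine div_le_one_of_le₀ ?_ (by positivity)
  have := norm_inner_le_norm (𝕜 := ℂ) ((InnerProductSpace.toDual ℂ F).symm g)
    ((InnerProductSpace.toDual ℂ F).symm h)
  simpa [dualInner] using this

/-- Cauchy–Schwarz keeps the radicands nonnegative, so the truncation in `Real.sqrt` loses nothing
and the distance is an injective function of the ratio. -/
theorem delta₁_eq_iff (g h g' h' : StrongDual ℂ F) : delta₁ g' h' = delta₁ g h ↔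
    ‖dualInner g' h'‖ / (‖g'‖ * ‖h'‖) = ‖dualInner g h‖ / (‖g‖ * ‖h‖) := by
  have h1 := norm_dualInner_div_le_one g h
  have h1' := norm_dualInner_div_le_one g' h'
  have h0 : 0 ≤ ‖dualInner g h‖ / (‖g‖ * ‖h‖) := by positivity
  have h0' : 0 ≤ ‖dualInner g' h'‖ / (‖g'‖ * ‖h'‖) := by positivity
  rw [delta₁, delta₁, ← mul_pow, ← mul_pow, ← div_pow, ← div_pow,
    Real.sqrt_inj (by nlinarith) (by nlinarith), sub_right_inj, sq_eq_sq₀ h0' h0]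

theorem delta₂_eq_iff (g h g' h' : StrongDual ℂ F) : delta₂ g' h' = delta₂ g h ↔
    ‖dualInner g' h'‖ / (‖g'‖ * ‖h'‖) = ‖dualInner g h‖ / (‖g‖ * ‖h‖) := by
  have h1 := norm_dualInner_div_le_one g h
  have h1' := norm_dualInner_div_le_one g' h'
  rw [delta₂, delta₂, Real.sqrt_inj (by linarith) (by linarith), sub_right_inj,
    mul_right_inj' two_ne_zero]

theorem HasKernel.normalizedSq_eq_norm_sq (hF : HasKernel F K) (x y : X) :
    normalizedSq K x y = (((‖dualInner (evalMap F x) (evalMap F y)‖ /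
      (‖evalMap F x‖ * ‖evalMap F y‖)) ^ 2 : ℝ) : ℂ) := by
  rw [normalizedSq, ← hF.norm_evalMap_sq, ← hF.norm_evalMap_sq, ← hF.dualInner_evalMap]
  push_cast
  ring

theorem HasKernel.norm_div_eq_iff (hF : HasKernel F K) (x y x' y' : X) :
    ‖dualInner (evalMap F x') (evalMap F y')‖ / (‖evalMap F x'‖ * ‖evalMap F y'‖) =
      ‖dualInner (evalMap F x) (evalMap F y)‖ / (‖evalMap F x‖ * ‖evalMap F y‖) ↔
    normalizedSq K x' y' = normalizedSq K x y := by
  rw [hF.normalizedSq_eq_norm_sq, hF.normalizedSq_eq_norm_sq, Complex.ofReal_inj,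
    sq_eq_sq₀ (by positivity) (by positivity)]

theorem HasKernel.pullbackDelta₁_eq_iff {n : ℕ} {X : Set (EuclideanSpace ℂ (Fin n))}
    [RKHS ℂ F X ℂ] {K : X → X → ℂ} (hF : HasKernel F K) (x y x' y' : X) :
    pullbackDelta₁ F x' y' = pullbackDelta₁ F x y ↔ normalizedSq K x' y' = normalizedSq K x y := by
  rw [pullbackDelta₁, pullbackDelta₁, delta₁_eq_iff, hF.norm_div_eq_iff]

theorem HasKernel.pullbackDelta₂_eq_iff {n : ℕ} {X : Set (EuclideanSpace ℂ (Fin n))}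
    [RKHS ℂ F X ℂ] {K : X → X → ℂ} (hF : HasKernel F K) (x y x' y' : X) :
    pullbackDelta₂ F x' y' = pullbackDelta₂ F x y ↔ normalizedSq K x' y' = normalizedSq K x y := by
  rw [pullbackDelta₂, pullbackDelta₂, delta₂_eq_iff, hF.norm_div_eq_iff]

theorem ne_zero_of_isRescaling (hK : IsNondegenerate K) {Φ : X → X} {ω : X → ℂ}
    (hω : ∀ x y, K (Φ x) (Φ y) = ω x * conj (ω y) * K x y) (x : X) : ω x ≠ 0 := by
  intro h0
  have := hω x x
  rw [h0, zero_mul, zero_mul] at this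
  exact (hK (Φ x)).ne' this

theorem HasKernel.normalizedSq_eq_of_isRescaling (hF : HasKernel F K) (hK : IsNondegenerate K)
    {Φ : X → X} {ω : X → ℂ} (hω : ∀ x y, K (Φ x) (Φ y) = ω x * conj (ω y) * K x y) (x y : X) :
    normalizedSq K (Φ x) (Φ y) = normalizedSq K x y := by
  rw [hF.normalizedSq_eq_iff hK, hω, hω, hω, hω]
  ring

end Normalized

/-! ### Transfer to the domain and its holomorphic self-maps -/

section Domain

open InnerProductSpace Filter Topology

variable {n : ℕ} {X : Set (EuclideanSpace ℂ (Fin n))}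

theorem ext_coe {V : Type*} [Zero V] (f : X → V) (x : X) : ext f x = f x :=
  Subtype.val_injective.extend_apply f 0 x

variable {F : Type*} [NormedAddCommGroup F] [InnerProductSpace ℂ F] [CompleteSpace F]
  [RKHS ℂ F X ℂ] {K : X → X → ℂ}

theorem HasKernel.differentiableOn_evalMap (hXo : IsOpen X) (hKs : IsSesquiHolomorphic K)
    (hF : HasKernel F K) : DifferentiableOn ℂ (ext (evalMap F)) X := by
  let k : EuclideanSpace ℂ (Fin n) → F := ext fun x : X => RKHS.kerFun F x (1 : ℂ)
  have hk : ∀ x : X, k x = RKHS.kerFun F x (1 : ℂ) := fun x => ext_coe _ x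
  have hdense : DenseRange (Finsupp.linearCombination ℂ (fun y : X => k y)) :=
    denseRange_linearCombination_of_kerFun_mem fun x => Submodule.subset_span ⟨x, hk x⟩
  have hd : ∀ y ∈ X, DifferentiableOn ℂ (fun x => inner ℂ (k x) (k y)) X := by
    intro y hy
    refine DifferentiableOn.congr (hKs.1 ⟨y, hy⟩) fun x hx => ?_
    rw [hk ⟨x, hx⟩, hk ⟨y, hy⟩, hF.inner_kerFun]
    exact (ext_coe (fun x => K x ⟨y, hy⟩) ⟨x, hx⟩).symm
  refine (differentiableOn_toDual hXo hdense hd).congr fun x hx => ?_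
  rw [hk ⟨x, hx⟩]
  exact ext_coe (evalMap F) ⟨x, hx⟩

/-- The evaluation map precomposed with a self-map of the domain. -/
noncomputable def evalMapComp (F : Type*) [NormedAddCommGroup F] [InnerProductSpace ℂ F] [CompleteSpace F]
    [RKHS ℂ F X ℂ] (Φ : X → X) : EuclideanSpace ℂ (Fin n) → StrongDual ℂ F :=
  fun z => ext (evalMap F) (ext (fun x => (Φ x : EuclideanSpace ℂ (Fin n))) z)

theorem evalMapComp_coe (Φ : X → X) (x : X) : evalMapComp F Φ x = evalMap F (Φ x) := by
  rw [evalMapComp, ext_coe, ext_coe]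

theorem hasFDerivAt_evalMapComp (hXo : IsOpen X) (hκ : DifferentiableOn ℂ (ext (evalMap F)) X)
    {Φ : X → X} (hΦ : IsHolomorphic fun x => (Φ x : EuclideanSpace ℂ (Fin n))) (x : X) :
    HasFDerivAt (evalMapComp F Φ) ((differential (evalMap F) (Φ x)).comp
      (differential (fun z => (Φ z : EuclideanSpace ℂ (Fin n))) x)) x := by
  have h1 := (hΦ.differentiableAt (hXo.mem_nhds x.2)).hasFDerivAt
  have h2 := (hκ.differentiableAt (hXo.mem_nhds (Φ x).2)).hasFDerivAt
  rw [← ext_coe (fun z => (Φ z : EuclideanSpace ℂ (Fin n))) x] at h2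
  have h3 := h2.comp (x : EuclideanSpace ℂ (Fin n)) h1
  rw [ext_coe] at h3
  exact h3

theorem HasKernel.exists_normalizedSq_eq_of_fubiniStudy (hXo : IsOpen X) (hX : X.Nonempty)
    (hF : HasKernel F K) (hKn : IsNondegenerate K) (hκ : DifferentiableOn ℂ (ext (evalMap F)) X)
    {Φ : X → X} (hΦ : IsHolomorphic fun x => (Φ x : EuclideanSpace ℂ (Fin n)))
    (hinv : ∀ (x : X) (u v : EuclideanSpace ℂ (Fin n)),
      pullbackFubiniStudy F (Φ x) (differential (fun z => (Φ z : EuclideanSpace ℂ (Fin n))) x u)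
        (differential (fun z => (Φ z : EuclideanSpace ℂ (Fin n))) x v) =
      pullbackFubiniStudy F x u v) :
    ∃ (y : X) (U : Set X), IsOpen U ∧ U.Nonempty ∧ ∀ x ∈ U,
      normalizedSq K (Φ x) (Φ y) = normalizedSq K x y := by
  obtain ⟨a, ha⟩ := hX
  have hder := hasFDerivAt_evalMapComp hXo hκ hΦ
  have key := eventually_dualInner_mul_eq hXo (κ := ext (evalMap F)) (l := evalMapComp F Φ) hκ
    (fun x hx => (hder ⟨x, hx⟩).differentiableAt.differentiableWithinAt) ha
    (by rw [ext_coe _ ⟨a, ha⟩]; exact hF.evalMap_ne_zero hKn _)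
    (by rw [evalMapComp_coe Φ ⟨a, ha⟩]; exact hF.evalMap_ne_zero hKn _)
    (fun x hx u => by
      rw [(hder ⟨x, hx⟩).fderiv, ext_coe _ ⟨x, hx⟩, evalMapComp_coe Φ ⟨x, hx⟩]
      exact (hinv ⟨x, hx⟩ u u).symm)
  obtain ⟨V, hV, hVo, haV⟩ := eventually_nhds_iff.1 key
  refine ⟨⟨a, ha⟩, Subtype.val ⁻¹' V, hVo.preimage continuous_subtype_val, ⟨⟨a, ha⟩, haV⟩,
    fun x hx => ?_⟩
  have h := hV x hx
  rw [hF.normalizedSq_eq_iff hKn]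
  simpa only [ext_coe _ ⟨a, ha⟩, ext_coe _ x, evalMapComp_coe Φ ⟨a, ha⟩, evalMapComp_coe Φ x,
    hF.dualInner_evalMap] using h

theorem HasKernel.isRescaling_of_normalizedSq_eq (hXo : IsOpen X) (hXc : IsPreconnected X)
    (hF : HasKernel F K) (hKn : IsNondegenerate K) (hκ : DifferentiableOn ℂ (ext (evalMap F)) X)
    {Φ : X → X} (hΦ : IsHolomorphic fun x => (Φ x : EuclideanSpace ℂ (Fin n))) {y : X} {U : Set X}
    (hUo : IsOpen U) (hU : U.Nonempty)
    (hinv : ∀ x ∈ U, normalizedSq K (Φ x) (Φ y) = normalizedSq K x y) :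
    IsRescaling (fun x y => K (Φ x) (Φ y)) K := by
  have hder := hasFDerivAt_evalMapComp hXo hκ hΦ
  obtain ⟨ω, hω⟩ := exists_rescaling_of_diagonal hXo hXc (κ := ext (evalMap F))
    (l := evalMapComp F Φ) hκ
    (fun x hx => (hder ⟨x, hx⟩).differentiableAt.differentiableWithinAt)
    (fun x hx => by rw [ext_coe _ ⟨x, hx⟩]; exact hF.evalMap_ne_zero hKn _)
    (fun x hx => by rw [evalMapComp_coe Φ ⟨x, hx⟩]; exact hF.evalMap_ne_zero hKn _)
    (U := Subtype.val '' U) (hXo.isOpenMap_subtype_val U hUo) (hU.image _)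
    (Subtype.coe_image_subset X U) y.2 (by
      rintro _ ⟨x, hx, rfl⟩
      have h := (hF.normalizedSq_eq_iff hKn _ _ _ _).1 (hinv x hx)
      simpa only [ext_coe, evalMapComp_coe, hF.dualInner_evalMap] using h)
  refine ⟨fun x => ω x, fun x y => ?_⟩
  have h := hω x x.2 y y.2
  simpa only [ext_coe, evalMapComp_coe, hF.dualInner_evalMap] using h

/-- Evaluating `W f` at `x` gives `(κ x).comp W = ω x • κ (Φ x)`, which is the situation of
`fubiniStudy_fderiv_eq_of_smul`. -/
theorem HasKernel.pullbackFubiniStudy_eq_of_unitary (hXo : IsOpen X)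
    (hF : HasKernel F K) (hKn : IsNondegenerate K) (hκ : DifferentiableOn ℂ (ext (evalMap F)) X)
    {Φ : X → X} (hΦ : IsHolomorphic fun x => (Φ x : EuclideanSpace ℂ (Fin n))) {ω : X → ℂ}
    {W : F →L[ℂ] F} (hWc : IsWeightedComposition F W ω Φ) (hW : W ∈ unitary (F →L[ℂ] F)) (x : X)
    (u v : EuclideanSpace ℂ (Fin n)) :
    pullbackFubiniStudy F (Φ x) (differential (fun z => (Φ z : EuclideanSpace ℂ (Fin n))) x u)
        (differential (fun z => (Φ z : EuclideanSpace ℂ (Fin n))) x v) =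
      pullbackFubiniStudy F x u v := by
  have hder := hasFDerivAt_evalMapComp hXo hκ hΦ x
  have key := fubiniStudy_fderiv_eq_of_smul hW (κ := ext (evalMap F)) (l := evalMapComp F Φ)
    (a := x) (hκ.differentiableAt (hXo.mem_nhds x.2)) hder.differentiableAt
    (by rw [ext_coe]; exact hF.evalMap_ne_zero hKn _)
    (by rw [evalMapComp_coe]; exact hF.evalMap_ne_zero hKn _) (ω := ext ω) (by
      filter_upwards [hXo.mem_nhds x.2] with z hz
      rw [ext_coe _ ⟨z, hz⟩, ext_coe ω ⟨z, hz⟩, evalMapComp_coe Φ ⟨z, hz⟩]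
      ext f
      simp [evalMap_apply, hWc f]) u v
  rw [hder.fderiv, ext_coe, evalMapComp_coe] at key
  exact key

end Domain

end ProjectiveKernel

/-! ### The equivalences -/

theorem mainTheorem2 {n : ℕ} {X : Set (EuclideanSpace ℂ (Fin n))}
    (hXo : IsOpen X) (hXc : IsConnected X)
    (K : X → X → ℂ)
    (hKs : ProjectiveKernel.IsSesquiHolomorphic K)
    (hKn : ProjectiveKernel.IsNondegenerate K)
    (hKp : ProjectiveKernel.IsPosSemidefKernel K)
    (F : Type*) [NormedAddCommGroup F] [InnerProductSpace ℂ F] [CompleteSpace F]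
    [RKHS ℂ F X ℂ] (hF : ProjectiveKernel.HasKernel F K) :
    List.TFAE [
      ProjectiveKernel.IsProjectivelyInvariant K,
      ∀ Φ : X ≃ X, ProjectiveKernel.IsAutomorphism Φ →
        ∃ (ω : X → ℂ) (W : F →L[ℂ] F),
          ProjectiveKernel.IsWeightedComposition F W ω Φ ∧ W ∈ unitary (F →L[ℂ] F),
      ProjectiveKernel.IsAutInvariantForm (ProjectiveKernel.pullbackFubiniStudy F),
      ProjectiveKernel.IsAutInvariantDist (ProjectiveKernel.pullbackDelta₁ F),
      ProjectiveKernel.IsAutInvariantDist (ProjectiveKernel.pullbackDelta₂ F),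
      ∀ Φ : X ≃ X, ProjectiveKernel.IsAutomorphism Φ →
        ∃ (y : X) (U : Set X), IsOpen U ∧ U.Nonempty ∧ ∀ x ∈ U,
          ProjectiveKernel.normalizedSq K (Φ x) (Φ y) = ProjectiveKernel.normalizedSq K x y] := by
  have hκ := hF.differentiableOn_evalMap hXo hKs
  have hne : Nonempty X := hXc.nonempty.to_subtype
  obtain ⟨a⟩ := hne
  tfae_have 1 → 2 := fun h Φ hΦ => by
    obtain ⟨ω, hω⟩ := h Φ hΦ
    exact hF.exists_unitary_of_isRescaling (ProjectiveKernel.ne_zero_of_isRescaling hKn hω) hω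
  tfae_have 2 → 3 := fun h Φ hΦ x u v => by
    obtain ⟨ω, W, hWc, hW⟩ := h Φ hΦ
    exact hF.pullbackFubiniStudy_eq_of_unitary hXo hKn hκ hΦ.1 hWc hW x u v
  tfae_have 3 → 6 := fun h Φ hΦ =>
    hF.exists_normalizedSq_eq_of_fubiniStudy hXo hXc.nonempty hKn hκ hΦ.1 (h Φ hΦ)
  tfae_have 6 → 1 := fun h Φ hΦ => by
    obtain ⟨y, U, hUo, hU, hinv⟩ := h Φ hΦ
    exact hF.isRescaling_of_normalizedSq_eq hXo hXc.isPreconnected hKn hκ hΦ.1 hUo hU hinv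
  tfae_have 1 → 4 := fun h Φ hΦ x y => by
    obtain ⟨ω, hω⟩ := h Φ hΦ
    exact (hF.pullbackDelta₁_eq_iff x y _ _).2 (hF.normalizedSq_eq_of_isRescaling hKn hω x y)
  tfae_have 4 → 5 := fun h Φ hΦ x y =>
    (hF.pullbackDelta₂_eq_iff x y _ _).2 ((hF.pullbackDelta₁_eq_iff x y _ _).1 (h Φ hΦ x y))
  tfae_have 5 → 6 := fun h Φ hΦ =>
    ⟨a, Set.univ, isOpen_univ, ⟨a, trivial⟩, fun x _ =>
      (hF.pullbackDelta₂_eq_iff x a _ _).1 (h Φ hΦ x a)⟩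
  tfae_finish
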